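/- Let $G$ be a finite group. An equivariant bispan from $X$ to $Y$ is a diagram $X\xleftarrow{p}A\xrightarrow{q}B\xrightarrow{r}Y$ of finite $G$-sets and equivariant maps. Let $\overline{\mathcal U}_G$ be the category whose objects are finite $G$-sets and whose morphisms $X\to Y$ are isomorphism classes of such bispans (an isomorphism is a pair of equivariant bijections $A\to A'$, $B\to B'$ commuting with all structure maps). The composite of $X_0\xleftarrow{p_0}A_0\xrightarrow{q_0}B_0\xrightarrow{r_0}X_1$ followed by $X_1\xleftarrow{p_1}A_1\xrightarrow{q_1}B_1\xrightarrow{r_1}X_2$ is $X_0\xleftarrow{p}A\xrightarrow{q}B\xrightarrow{r}X_2$, where $B$ is the set of pairs $(b_1,s)$ with $b_1\in B_1$ and $s\colon q_1^{-1}\{b_1\}\to B_0$ any (not necessarily equivariant) function satisfying $r_0s=p_1$; $A$ is the set of triples $(a_0,a_1,s)$ with $a_0\in A_0$, $a_1\in A_1$, $(q_1(a_1),s)\in B$ and $q_0(a_0)=s(a_1)$; the maps are $p(a_0,a_1,s)=p_0(a_0)$, $q(a_0,a_1,s)=(q_1(a_1),s)$, $r(b_1,s)=r_1(b_1)$; and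 $G$ acts by conjugation on the functions $s$. In $\overline{\mathcal U}_G$ the disjoint union $X\amalg Y$ is a product of $X$ and $Y$, and $\emptyset$ is terminal. A *Tambara functor* is a functor $S\colon\overline{\mathcal U}_G\to\mathrm{Sets}$ preserving finite products. For an equivariant map $f\colon X\to Y$ write $R_f\colon S(Y)\to S(X)$, $N_f\colon S(X)\to S(Y)$ and $T_f\colon S(X)\to S(Y)$ for the maps induced by the bispans $Y\xleftarrow{f}X=X=X$, $\;X=X\xrightarrow{f}Y=Y$ and $X=X=X\xrightarrow{f}Y$. Each $S(X)$ is a commutative semiring with $a+b=T_s(a,b)$, $ab=N_s(a,b)$, $0=T_z(*)$, $1=N_z(*)$, where $s\colon X\amalg X\to X$ is the fold map, $z\colon\emptyset\to X$ is the inclusion, $S(X\amalg X)$ is identified with $S(X)\times S(X)$ by restriction, and $*$ is the unique element of $S(\emptyset)$. Say that $S$ is *additively complete* if every element of every $S(X)$ has an additive inverse, so that all $S(X)$ are rings. A *congruence* on $S$ is a sub-Tambara functor $E\le S\times S$ (a subfunctor which itself preserves finite products) such that for every $X$ the subset $E(X)\subseteq S(X)\times S(X)$ is an equivalence relation on $S(X)$.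 A *Tambara ideal* in $S$ is a family of ideals $I(X)\le S(X)$, one for each finite $G$-set $X$, such that for every equivariant map $f\colon X\to Y$ of finite $G$-sets $$R_f(I(Y))\subseteq I(X),\qquad T_f(I(X))\subseteq I(Y),\qquad N_f(I(X))\subseteq I(Y)+N_f(0).$$ **Proposition.** Let $S$ be an additively complete Tambara functor. For every congruence $E$ on $S$, the sets $$I_E(X)=\{a\in S(X) : (a,0)\in E(X)\}$$ form a Tambara ideal $I_E$ in $S$, and $E\mapsto I_E$ is a bijection from the set of congruences on $S$ to the set of Tambara ideals in $S$. -/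

import Mathlib

universe u v w

namespace Tambara

open CategoryTheory Limits Function

/-- A finite `G`-set. -/
structure FinGSet (G : Type v) [Group G] where
  /-- the underlying set -/
  carrier : Type u
  [finite : Finite carrier]
  [action : MulAction G carrier]

variable {G : Type v} [Group G]

instance : CoeSort (FinGSet.{u} G) (Type u) := ⟨FinGSet.carrier⟩

attribute [instance] FinGSet.finite FinGSet.action

/-- An equivariant bispan `X ← A → B → Y` of finite `G`-sets. -/
structure Bispan (X Y : FinGSet.{u} G) where
  A : FinGSet.{u} G
  B : FinGSet.{u} G
  p : A →[G] X
  q : A →[G] B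
  r : B →[G] Y

namespace Bispan

variable {X Y Z W : FinGSet.{u} G}

/-- Two bispans are isomorphic if there are equivariant bijections `A → A'` and `B → B'`
compatible with all structure maps. -/
def IsIso (ω ω' : Bispan X Y) : Prop :=
  ∃ (α : ω.A →[G] ω'.A) (β : ω.B →[G] ω'.B), Bijective α ∧ Bijective β ∧
    (∀ a, ω'.p (α a) = ω.p a) ∧ (∀ a, ω'.q (α a) = β (ω.q a)) ∧ (∀ b, ω'.r (β b) = ω.r b)

theorem IsIso.refl (ω : Bispan X Y) : IsIso ω ω :=
  ⟨MulActionHom.id G, MulActionHom.id G, bijective_id, bijective_id, fun _ => rfl, fun _ => rfl,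
    fun _ => rfl⟩

theorem IsIso.symm {ω ω' : Bispan X Y} (h : IsIso ω ω') : IsIso ω' ω := by
  obtain ⟨α, β, hα, hβ, hp, hq, hr⟩ := h
  obtain ⟨α', h₁, h₂⟩ := bijective_iff_has_inverse.1 hα
  obtain ⟨β', h₃, h₄⟩ := bijective_iff_has_inverse.1 hβ
  refine ⟨α.inverse α' h₁ h₂, β.inverse β' h₃ h₄, ⟨h₂.injective, h₁.surjective⟩,
    ⟨h₄.injective, h₃.surjective⟩, fun a => ?_, fun a => ?_, fun b => ?_⟩
  · change ω.p (α' a) = ω'.p a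
    rw [← hp, h₂]
  · change ω.q (α' a) = β' (ω'.q a)
    rw [← h₃ (ω.q (α' a)), ← hq, h₂]
  · change ω.r (β' b) = ω'.r b
    rw [← hr, h₄]

theorem IsIso.trans {ω ω' ω'' : Bispan X Y} (h : IsIso ω ω') (h' : IsIso ω' ω'') :
    IsIso ω ω'' := by
  obtain ⟨α, β, hα, hβ, hp, hq, hr⟩ := h
  obtain ⟨α', β', hα', hβ', hp', hq', hr'⟩ := h'
  refine ⟨α'.comp α, β'.comp β, hα'.comp hα, hβ'.comp hβ, fun a => ?_, fun a => ?_, fun b => ?_⟩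
  · simp [hp', hp]
  · simp [hq', hq]
  · simp [hr', hr]

/-- The setoid of isomorphism of bispans. -/
instance setoid (X Y : FinGSet.{u} G) : Setoid (Bispan X Y) :=
  ⟨IsIso, IsIso.refl, IsIso.symm, IsIso.trans⟩

/-- The identity bispan. -/
def id (X : FinGSet.{u} G) : Bispan X X :=
  ⟨X, X, MulActionHom.id G, MulActionHom.id G, MulActionHom.id G⟩

/-- The middle object `B` of a composite: pairs `(b₁, s)` where `b₁ ∈ B₁` and
`s : q₁⁻¹{b₁} → B₀` satisfies `r₀ s = p₁`. -/
structure CompB (ω₀ : Bispan X Y) (ω₁ : Bispan Y Z) where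
  b : ω₁.B
  s : {a : ω₁.A // ω₁.q a = b} → ω₀.B
  hs : ∀ a, ω₀.r (s a) = ω₁.p a

/-- The middle object `A` of a composite: triples `(a₀, a₁, s)` where `(b, s)` is a point of
`CompB` with `b = q₁(a₁)`, and `q₀(a₀) = s(a₁)`. -/
structure CompA (ω₀ : Bispan X Y) (ω₁ : Bispan Y Z) where
  b : CompB ω₀ ω₁
  a₁ : ω₁.A
  h₁ : ω₁.q a₁ = b.b
  a₀ : ω₀.A
  h₀ : ω₀.q a₀ = b.s ⟨a₁, h₁⟩

theorem CompB.ext' {ω₀ : Bispan X Y} {ω₁ : Bispan Y Z} {c d : CompB ω₀ ω₁} (h : c.b = d.b)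
    (h' : ∀ a h₁ h₂, c.s ⟨a, h₁⟩ = d.s ⟨a, h₂⟩) : c = d := by
  obtain ⟨b, s, hs⟩ := c
  obtain ⟨b', s', hs'⟩ := d
  obtain rfl : b = b' := h
  obtain rfl : s = s' := funext fun a => h' a.1 a.2 a.2
  rfl

theorem CompB.s_congr {ω₀ : Bispan X Y} {ω₁ : Bispan Y Z} {c d : CompB ω₀ ω₁} (h : c = d)
    {a a' : ω₁.A} (ha : a = a') (h₁ : ω₁.q a = c.b) (h₂ : ω₁.q a' = d.b) :
    c.s ⟨a, h₁⟩ = d.s ⟨a', h₂⟩ := by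
  subst h ha; rfl

theorem CompA.ext' {ω₀ : Bispan X Y} {ω₁ : Bispan Y Z} {c d : CompA ω₀ ω₁} (h : c.b = d.b)
    (h' : c.a₁ = d.a₁) (h'' : c.a₀ = d.a₀) : c = d := by
  cases c; cases d; cases h; cases h'; cases h''; rfl

instance (ω₀ : Bispan X Y) (ω₁ : Bispan Y Z) : Finite (CompB ω₀ ω₁) :=
  Finite.of_injective
    (β := Σ b : ω₁.B, ({a : ω₁.A // ω₁.q a = b} → ω₀.B)) (fun c => ⟨c.b, c.s⟩) (by
      rintro ⟨b, s, hs⟩ ⟨b', s', hs'⟩ h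
      cases h
      rfl)

instance (ω₀ : Bispan X Y) (ω₁ : Bispan Y Z) : Finite (CompA ω₀ ω₁) :=
  Finite.of_injective (β := CompB ω₀ ω₁ × ω₁.A × ω₀.A) (fun c => (c.b, c.a₁, c.a₀)) (by
    intro c d h
    simp only [Prod.mk.injEq] at h
    exact CompA.ext' h.1 h.2.1 h.2.2)

/-- The action `g • (b₁, s) = (g b₁, g s g⁻¹)`. -/
instance (ω₀ : Bispan X Y) (ω₁ : Bispan Y Z) : SMul G (CompB ω₀ ω₁) where
  smul g c :=
    { b := g • c.b
      s := fun a => g • c.s ⟨g⁻¹ • a.1, by rw [map_smul, a.2, inv_smul_smul]⟩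
      hs := fun a => by rw [map_smul, c.hs, map_smul, smul_inv_smul] }

theorem CompB.smul_b {ω₀ : Bispan X Y} {ω₁ : Bispan Y Z} (g : G) (c : CompB ω₀ ω₁) :
    (g • c).b = g • c.b := rfl

theorem CompB.smul_s {ω₀ : Bispan X Y} {ω₁ : Bispan Y Z} (g : G) (c : CompB ω₀ ω₁)
    (a : ω₁.A) (h : ω₁.q a = g • c.b) (h' : ω₁.q (g⁻¹ • a) = c.b) :
    (g • c).s ⟨a, h⟩ = g • c.s ⟨g⁻¹ • a, h'⟩ := rfl

theorem CompB.smul_s_smul {ω₀ : Bispan X Y} {ω₁ : Bispan Y Z} (g : G) (c : CompB ω₀ ω₁)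
    (a : ω₁.A) (h : ω₁.q (g • a) = g • c.b) (h' : ω₁.q a = c.b) :
    (g • c).s ⟨g • a, h⟩ = g • c.s ⟨a, h'⟩ := by
  rw [CompB.smul_s g c _ _ (by rw [inv_smul_smul]; exact h')]
  congr 1
  exact CompB.s_congr rfl (inv_smul_smul g a) _ _

instance (ω₀ : Bispan X Y) (ω₁ : Bispan Y Z) : MulAction G (CompB ω₀ ω₁) where
  one_smul c := CompB.ext' (one_smul G c.b) fun a h₁ h₂ => by
    rw [CompB.smul_s 1 c a h₁ (by rw [inv_one, one_smul]; exact h₂), one_smul]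
    exact CompB.s_congr rfl (by rw [inv_one, one_smul]) _ _
  mul_smul g h c := CompB.ext' (mul_smul g h c.b) fun a h₁ h₂ => by
    have h₁' : ω₁.q a = (g * h) • c.b := h₁
    have e1 : ω₁.q (g⁻¹ • a) = h • c.b := by
      rw [map_smul, h₁', mul_smul, inv_smul_smul]
    have e2 : ω₁.q (h⁻¹ • g⁻¹ • a) = c.b := by
      rw [map_smul, e1, inv_smul_smul]
    rw [CompB.smul_s (g * h) c a h₁ (by rw [mul_inv_rev, mul_smul]; exact e2),
      CompB.smul_s g (h • c) a h₂ e1, CompB.smul_s h c _ e1 e2, mul_smul]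
    congr 2
    exact CompB.s_congr rfl (by rw [mul_inv_rev, mul_smul]) _ _

/-- The action `g • (a₀, a₁, s) = (g a₀, g a₁, g s g⁻¹)`. -/
instance (ω₀ : Bispan X Y) (ω₁ : Bispan Y Z) : SMul G (CompA ω₀ ω₁) where
  smul g c :=
    { b := g • c.b
      a₁ := g • c.a₁
      h₁ := by rw [map_smul, c.h₁]; rfl
      a₀ := g • c.a₀
      h₀ := by rw [map_smul, c.h₀, CompB.smul_s_smul] }

instance (ω₀ : Bispan X Y) (ω₁ : Bispan Y Z) : MulAction G (CompA ω₀ ω₁) where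
  one_smul c := CompA.ext' (one_smul G c.b) (one_smul G c.a₁) (one_smul G c.a₀)
  mul_smul g h c := CompA.ext' (mul_smul g h c.b) (mul_smul g h c.a₁) (mul_smul g h c.a₀)

/-- The composite `ω₁ ∘ ω₀` of bispans (in diagrammatic order). -/
def comp (ω₀ : Bispan X Y) (ω₁ : Bispan Y Z) : Bispan X Z where
  A := ⟨CompA ω₀ ω₁⟩
  B := ⟨CompB ω₀ ω₁⟩
  p := ⟨fun c => ω₀.p c.a₀, fun g c => map_smul ω₀.p g c.a₀⟩
  q := ⟨fun c => c.b, fun _ _ => rfl⟩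
  r := ⟨fun c => ω₁.r c.b, fun g c => map_smul ω₁.r g c.b⟩

/-- A criterion for a bispan to be isomorphic to a composite. -/
theorem IsIso.comp_of {ω₀ : Bispan X Y} {ω₁ : Bispan Y Z} {ω : Bispan X Z}
    (β : ω.B → CompB ω₀ ω₁) (hβ : Bijective β) (hβG : ∀ (g : G) b, β (g • b) = g • β b)
    (α₀ : ω.A →[G] ω₀.A) (α₁ : ω.A →[G] ω₁.A)
    (h₁ : ∀ a, ω₁.q (α₁ a) = (β (ω.q a)).b)
    (h₀ : ∀ a, ω₀.q (α₀ a) = (β (ω.q a)).s ⟨α₁ a, h₁ a⟩)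
    (hp : ∀ a, ω₀.p (α₀ a) = ω.p a) (hr : ∀ b, ω₁.r (β b).b = ω.r b)
    (hA : ∀ (b : ω.B) (a₀ : ω₀.A) (a₁ : ω₁.A) (h₁ : ω₁.q a₁ = (β b).b),
      ω₀.q a₀ = (β b).s ⟨a₁, h₁⟩ → ∃! a, ω.q a = b ∧ α₀ a = a₀ ∧ α₁ a = a₁) :
    IsIso ω (comp ω₀ ω₁) := by
  refine ⟨⟨fun a => (⟨β (ω.q a), α₁ a, h₁ a, α₀ a, h₀ a⟩ : CompA ω₀ ω₁), fun g a => ?_⟩,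
    ⟨show ω.B → CompB ω₀ ω₁ from β, hβG⟩, ?_, hβ, hp, fun _ => rfl, hr⟩
  · exact CompA.ext' (by change β _ = g • β _; rw [map_smul, hβG])
      (map_smul α₁ g a) (map_smul α₀ g a)
  · constructor
    · intro a a' h
      have e1 := hβ.1 (congrArg CompA.b h)
      have e2 : α₁ a = α₁ a' := congrArg CompA.a₁ h
      have e3 : α₀ a = α₀ a' := congrArg CompA.a₀ h
      exact (hA (ω.q a') (α₀ a') (α₁ a') (h₁ a') (h₀ a')).unique ⟨e1, e3, e2⟩ ⟨rfl, rfl, rfl⟩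
    · rintro ⟨b, a₁, e₁, a₀, e₀⟩
      obtain ⟨b, rfl⟩ := hβ.2 b
      obtain ⟨a, ⟨e2, e3, e4⟩, -⟩ := hA b a₀ a₁ e₁ e₀
      exact ⟨a, CompA.ext' (congrArg β e2) e4 e3⟩

theorem id_comp (ω : Bispan X Y) : IsIso ω (comp (id X) ω) := by
  refine IsIso.comp_of (ω₀ := id X) (ω₁ := ω) (fun b => ⟨b, fun a => ω.p a.1, fun a => rfl⟩) ⟨?_, ?_⟩ ?_ ω.p
    (MulActionHom.id G) (fun _ => rfl) (fun _ => rfl) (fun _ => rfl) (fun _ => rfl) ?_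
  · intro b b' h
    exact congrArg CompB.b h
  · rintro ⟨b, s, hs⟩
    exact ⟨b, CompB.ext' rfl fun a h h' => (hs ⟨a, h⟩).symm⟩
  · intro g b
    refine CompB.ext' rfl fun a h h' => ?_
    change ω.p a = g • ω.p (g⁻¹ • a)
    rw [← map_smul, smul_inv_smul]
  · intro b a₀ a₁ h₁ h₀
    exact ⟨a₁, ⟨h₁, h₀.symm, rfl⟩, fun a h => h.2.2⟩

theorem comp_id (ω : Bispan X Y) : IsIso ω (comp ω (id Y)) := by
  refine IsIso.comp_of (ω₀ := ω) (ω₁ := id Y) (fun b => ⟨ω.r b, fun a => b, fun a => a.2.symm⟩) ⟨?_, ?_⟩ ?_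
    (MulActionHom.id G) (ω.r.comp ω.q) (fun _ => rfl) (fun _ => rfl) (fun _ => rfl)
    (fun _ => rfl) ?_
  · intro b b' h
    exact CompB.s_congr h (congrArg CompB.b h) rfl rfl
  · rintro ⟨b, s, hs⟩
    refine ⟨s ⟨b, rfl⟩, CompB.ext' (hs _) ?_⟩
    intro a h h'
    obtain rfl : a = b := h'
    rfl
  · intro g b
    exact CompB.ext' (map_smul ω.r g b) fun a h h' => rfl
  · intro b a₀ a₁ h₁ h₀
    refine ⟨a₀, ⟨h₀, rfl, ?_⟩, fun a h => h.2.1⟩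
    change ω.r (ω.q a₀) = a₁
    rw [h₀]; exact h₁.symm

theorem comp_congr {ω₀ ω₀' : Bispan X Y} {ω₁ ω₁' : Bispan Y Z} (h₀ : IsIso ω₀ ω₀')
    (h₁ : IsIso ω₁ ω₁') : IsIso (comp ω₀ ω₁) (comp ω₀' ω₁') := by
  obtain ⟨α, β, hα, hβ, hp, hq, hr⟩ := h₀
  obtain ⟨α', β', hα', hβ', hp', hq', hr'⟩ := h₁
  obtain ⟨γ, hγ₁, hγ₂⟩ := bijective_iff_has_inverse.1 hα'
  have key : ∀ (b : ω₁.B) (a : ω₁'.A), ω₁'.q a = β' b → ω₁.q (γ a) = b := fun b a h =>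
    hβ'.1 (by rw [← hq', hγ₂, h])
  refine IsIso.comp_of (ω₀ := ω₀') (ω₁ := ω₁')
    (fun c : CompB ω₀ ω₁ => ⟨β' c.b, fun a => β (c.s ⟨γ a.1, key _ _ a.2⟩), fun a => ?_⟩)
    ⟨?_, ?_⟩ ?_ ⟨fun c : CompA ω₀ ω₁ => α c.a₀, fun g c => map_smul α g c.a₀⟩
    ⟨fun c : CompA ω₀ ω₁ => α' c.a₁, fun g c => map_smul α' g c.a₁⟩
    (fun c : CompA ω₀ ω₁ => ?_) (fun c : CompA ω₀ ω₁ => ?_) (fun c : CompA ω₀ ω₁ => hp c.a₀)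
    (fun c : CompB ω₀ ω₁ => hr' c.b) ?_
  · rw [hr, c.hs, ← hp', hγ₂]
  · intro c d h
    refine CompB.ext' (hβ'.1 (congrArg CompB.b h)) fun a h₁ h₂ => hβ.1 ?_
    have e1 : ω₁'.q (α' a) = β' c.b := by rw [hq', h₁]
    have e2 : ω₁'.q (α' a) = β' d.b := by rw [hq', h₂]
    have := CompB.s_congr h (a := α' a) rfl e1 e2
    refine Eq.trans ?_ (this.trans ?_)
    · exact congrArg β (CompB.s_congr rfl (hγ₁ a).symm _ _)
    · exact congrArg β (CompB.s_congr rfl (hγ₁ a) _ _)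
  · rintro ⟨b, s, hs⟩
    obtain ⟨b, rfl⟩ := hβ'.2 b
    choose t ht using fun a => hβ.2 (s a)
    refine ⟨(⟨b, fun a => t ⟨α' a.1, by rw [hq', a.2]⟩, fun a => ?_⟩ : CompB ω₀ ω₁), ?_⟩
    · rw [← hr, ht, hs, hp']
    · refine CompB.ext' rfl fun a h h' => ?_
      change β (t _) = _
      rw [ht]
      congr 2
      exact hγ₂ a
  · intro g c
    refine CompB.ext' (map_smul β' g _) fun a h h' => ?_
    have hc : ω₁'.q (g⁻¹ • a) = β' c.b := by
      rw [map_smul, h', CompB.smul_b, inv_smul_smul]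
    rw [CompB.smul_s g _ a h' hc]
    change β ((g • c).s ⟨γ a, _⟩) = g • β (c.s ⟨γ (g⁻¹ • a), _⟩)
    have e1 : ω₁.q (γ a) = g • CompB.b c := key (g • CompB.b c) a h
    have e2 : ω₁.q (g⁻¹ • γ a) = CompB.b c := by rw [map_smul, e1, inv_smul_smul]
    refine Eq.trans (congrArg β (CompB.smul_s g c (γ a) e1 e2)) ?_
    rw [map_smul]
    congr 2
    refine CompB.s_congr rfl (hα'.1 ?_) _ _
    rw [map_smul, hγ₂, hγ₂]
  · exact (hq' c.a₁).trans (congrArg β' c.h₁)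
  · refine (hq c.a₀).trans (congrArg β ?_)
    rw [c.h₀]
    exact CompB.s_congr rfl (hγ₁ c.a₁).symm _ _
  · intro c a₀ a₁ e₁ e₀
    obtain ⟨a₀, rfl⟩ := hα.2 a₀
    obtain ⟨a₁, rfl⟩ := hα'.2 a₁
    have e₁' : ω₁.q a₁ = CompB.b c := hβ'.1 (by rw [← hq']; exact e₁)
    refine ⟨(⟨c, a₁, e₁', a₀, hβ.1 ?_⟩ : CompA ω₀ ω₁), ⟨rfl, rfl, rfl⟩, ?_⟩
    · rw [← hq, e₀]
      exact congrArg β (CompB.s_congr rfl (hγ₁ a₁) _ _)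
    · rintro d ⟨h1, h2, h3⟩
      exact CompA.ext' h1 (hα'.1 h3) (hα.1 h2)

/-- The comparison map between the middle objects of two triple composites. -/
def assocB (ω₀ : Bispan X Y) (ω₁ : Bispan Y Z) (ω₂ : Bispan Z W)
    (c : CompB (comp ω₀ ω₁) ω₂) : CompB ω₀ (comp ω₁ ω₂) where
  b := (⟨c.b, fun a => CompB.b (c.s a), fun a => c.hs a⟩ : CompB ω₁ ω₂)
  s := fun a => CompB.s (c.s ⟨CompA.a₁ a.1, (CompA.h₁ a.1).trans (congrArg CompB.b a.2)⟩)
    ⟨CompA.a₀ a.1, (CompA.h₀ a.1).trans (CompB.s_congr a.2 rfl _ _)⟩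
  hs := fun a => CompB.hs (c.s ⟨CompA.a₁ a.1, _⟩) _

theorem assoc (ω₀ : Bispan X Y) (ω₁ : Bispan Y Z) (ω₂ : Bispan Z W) :
    IsIso (comp (comp ω₀ ω₁) ω₂) (comp ω₀ (comp ω₁ ω₂)) := by
  have hsmul : ∀ (g : G) (c : CompB (comp ω₀ ω₁) ω₂),
      assocB ω₀ ω₁ ω₂ (g • c) = g • assocB ω₀ ω₁ ω₂ c := by
    intro g c
    refine CompB.ext' (CompB.ext' rfl fun a h h' => rfl) ?_
    rintro ⟨d, a₂, h₂, a₁, h₁⟩ e e'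
    rfl
  refine IsIso.comp_of (ω := comp (comp ω₀ ω₁) ω₂) (assocB ω₀ ω₁ ω₂) ⟨?_, ?_⟩ hsmul
    ⟨fun c : CompA (comp ω₀ ω₁) ω₂ => CompA.a₀ c.a₀, fun g c => rfl⟩
    ⟨fun c : CompA (comp ω₀ ω₁) ω₂ =>
      (⟨(assocB ω₀ ω₁ ω₂ c.b).b, c.a₁, c.h₁, CompA.a₁ c.a₀, (CompA.h₁ c.a₀).trans
        (congrArg CompB.b c.h₀)⟩ : CompA ω₁ ω₂), fun g c => ?_⟩
    (fun c => rfl) ?_ (fun c => rfl) (fun c => rfl) ?_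
  · intro c d h
    have hb : ((assocB ω₀ ω₁ ω₂ c).b : CompB ω₁ ω₂) = (assocB ω₀ ω₁ ω₂ d).b :=
      congrArg CompB.b h
    refine CompB.ext' (show CompB.b c = CompB.b d from congrArg (fun x : CompB ω₁ ω₂ => x.b) hb)
      fun a h₁ h₂ => CompB.ext' (CompB.s_congr hb rfl h₁ h₂) fun a' e₁ e₂ => ?_
    exact CompB.s_congr h (a := (⟨(assocB ω₀ ω₁ ω₂ c).b, a, h₁, a', e₁⟩ : CompA ω₁ ω₂))
      (a' := (⟨(assocB ω₀ ω₁ ω₂ d).b, a, h₂, a', e₂⟩ : CompA ω₁ ω₂))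
      (CompA.ext' hb rfl rfl) rfl rfl
  · rintro ⟨⟨b, s, hs⟩, t, ht⟩
    refine ⟨⟨b, fun a => (⟨s a, fun a' => t ⟨(⟨⟨b, s, hs⟩, a.1, a.2, a'.1, a'.2⟩ : CompA ω₁ ω₂),
      rfl⟩, fun a' => ht _⟩ : CompB ω₀ ω₁), fun a => hs a⟩, ?_⟩
    refine CompB.ext' rfl ?_
    rintro ⟨d, a₂, h₂, a₁, h₁⟩ e e'
    obtain rfl : d = ⟨b, s, hs⟩ := e'
    rfl
  · exact CompA.ext' (congrArg CompB.b (hsmul g c.b)) rfl rfl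
  · intro c
    refine (CompA.h₀ c.a₀).trans ?_
    exact CompB.s_congr c.h₀ rfl _ _
  · rintro c a₀ ⟨d, a₂, h₂, a₁, h₁⟩ e₁ e₀
    obtain rfl : d = (assocB ω₀ ω₁ ω₂ c).b := e₁
    refine ⟨(⟨c, a₂, h₂, (⟨CompB.s c ⟨a₂, h₂⟩, a₁, h₁, a₀, e₀⟩ : CompA ω₀ ω₁), rfl⟩ :
      CompA (comp ω₀ ω₁) ω₂), ⟨rfl, rfl, rfl⟩, ?_⟩
    rintro ⟨c', a₂', h₂', ⟨d', a₁', h₁', a₀', h₀'⟩, e⟩ ⟨k1, k2, k3⟩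
    obtain rfl : c' = c := k1
    obtain rfl : a₀' = a₀ := k2
    obtain rfl : a₂' = a₂ := congrArg CompA.a₁ k3
    obtain rfl : a₁' = a₁ := congrArg CompA.a₀ k3
    obtain rfl : d' = CompB.s c' ⟨a₂', h₂⟩ := e
    rfl

end Bispan

/-- The category whose objects are finite `G`-sets and whose morphisms are isomorphism classes of
equivariant bispans. -/
instance : Category (FinGSet.{u} G) where
  Hom X Y := Quotient (Bispan.setoid X Y)
  id X := Quotient.mk _ (Bispan.id X)
  comp f g := Quotient.map₂ Bispan.comp (fun _ _ h _ _ h' => Bispan.comp_congr h h') f g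
  id_comp := by
    rintro X Y ⟨ω⟩
    exact Quotient.sound (Bispan.id_comp ω).symm
  comp_id := by
    rintro X Y ⟨ω⟩
    exact Quotient.sound (Bispan.comp_id ω).symm
  assoc := by
    rintro X Y Z W ⟨ω₀⟩ ⟨ω₁⟩ ⟨ω₂⟩
    exact Quotient.sound (Bispan.assoc ω₀ ω₁ ω₂)


namespace FinGSet

/-- The empty `G`-set. -/
def empty : FinGSet.{u} G where
  carrier := PEmpty
  action :=
    { smul := fun _ x => x
      one_smul := fun x => x.elim
      mul_smul := fun _ _ x => x.elim }

/-- The disjoint union of two finite `G`-sets. -/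
def sum (X Y : FinGSet.{u} G) : FinGSet.{u} G := ⟨X ⊕ Y⟩

variable {X Y Z X' Y' : FinGSet.{u} G}

/-- The map from the empty `G`-set. -/
def fromEmpty (X : FinGSet.{u} G) : (empty : FinGSet.{u} G) →[G] X :=
  ⟨fun x => PEmpty.elim x, fun _ x => PEmpty.elim x⟩

/-- The left inclusion `X → X ⊔ Y`. -/
def inl : X →[G] sum X Y := ⟨Sum.inl, fun _ _ => rfl⟩

/-- The right inclusion `Y → X ⊔ Y`. -/
def inr : Y →[G] sum X Y := ⟨Sum.inr, fun _ _ => rfl⟩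

/-- The map `X ⊔ Y → Z` with given restrictions. -/
def desc (f : X →[G] Z) (g : Y →[G] Z) : sum X Y →[G] Z :=
  ⟨Sum.elim f g, by rintro c (x | y); exacts [map_smul f c x, map_smul g c y]⟩

/-- The map `f ⊔ g`. -/
def sumMap (f : X →[G] X') (g : Y →[G] Y') : sum X Y →[G] sum X' Y' :=
  desc (inl.comp f) (inr.comp g)

/-- The fold map `X ⊔ X → X`. -/
def fold (X : FinGSet.{u} G) : sum X X →[G] X := desc (MulActionHom.id G) (MulActionHom.id G)

end FinGSet

open FinGSet

section Generators

variable {X Y Z W : FinGSet.{u} G}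

/-- The morphism represented by a bispan. -/
def cls (ω : Bispan X Y) : X ⟶ Y := Quotient.mk (Bispan.setoid X Y) ω

/-- `R_f = [Y ← X = X = X]`. -/
def Rb (f : X →[G] Y) : Y ⟶ X := cls ⟨X, X, f, MulActionHom.id G, MulActionHom.id G⟩

/-- `N_f = [X = X → Y = Y]`. -/
def Nb (f : X →[G] Y) : X ⟶ Y := cls ⟨X, Y, MulActionHom.id G, f, MulActionHom.id G⟩

/-- `T_f = [X = X = X → Y]`. -/
def Tb (f : X →[G] Y) : X ⟶ Y := cls ⟨X, X, MulActionHom.id G, MulActionHom.id G, f⟩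

theorem cls_comp_Tb {A B : FinGSet.{u} G} (p : A →[G] X) (q : A →[G] B) (r : B →[G] Y)
    (f : Y →[G] Z) : cls ⟨A, B, p, q, r⟩ ≫ Tb f = cls ⟨A, B, p, q, f.comp r⟩ := by
  refine (Quotient.sound ?_).symm
  refine Bispan.IsIso.comp_of (ω := ⟨A, B, p, q, f.comp r⟩) (ω₀ := ⟨A, B, p, q, r⟩)
    (ω₁ := ⟨Y, Y, MulActionHom.id G, MulActionHom.id G, f⟩)
    (fun b => ⟨r b, fun _ => b, fun a => a.2.symm⟩) ⟨?_, ?_⟩ ?_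
    (MulActionHom.id G) (r.comp q) (fun _ => rfl) (fun _ => rfl) (fun _ => rfl) (fun _ => rfl) ?_
  · intro b b' h
    exact Bispan.CompB.s_congr h (congrArg Bispan.CompB.b h) rfl rfl
  · rintro ⟨b, s, hs⟩
    refine ⟨s ⟨b, rfl⟩, Bispan.CompB.ext' (hs _) ?_⟩
    intro a h h'
    obtain rfl : a = b := h'
    rfl
  · intro g b
    exact Bispan.CompB.ext' (map_smul r g b) fun a h h' => rfl
  · intro b a₀ a₁ h₁ h₀
    refine ⟨a₀, ⟨h₀, rfl, ?_⟩, fun a h => h.2.1⟩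
    change r (q a₀) = a₁
    rw [show q a₀ = b from h₀]; exact h₁.symm

theorem cls_comp_Nb {A : FinGSet.{u} G} (p : A →[G] X) (q : A →[G] Y) (f : Y →[G] Z) :
    cls ⟨A, Y, p, q, MulActionHom.id G⟩ ≫ Nb f =
      cls ⟨A, Z, p, f.comp q, MulActionHom.id G⟩ := by
  refine (Quotient.sound ?_).symm
  refine Bispan.IsIso.comp_of (ω := ⟨A, Z, p, f.comp q, MulActionHom.id G⟩)
    (ω₀ := ⟨A, Y, p, q, MulActionHom.id G⟩)
    (ω₁ := ⟨Y, Z, MulActionHom.id G, f, MulActionHom.id G⟩)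
    (fun z => ⟨z, fun y => y.1, fun _ => rfl⟩) ⟨?_, ?_⟩ ?_
    (MulActionHom.id G) q (fun _ => rfl) (fun _ => rfl) (fun _ => rfl) (fun _ => rfl) ?_
  · intro b b' h
    exact congrArg Bispan.CompB.b h
  · rintro ⟨b, s, hs⟩
    exact ⟨b, Bispan.CompB.ext' rfl fun a h h' => (hs ⟨a, h⟩).symm⟩
  · intro g b
    exact Bispan.CompB.ext' rfl fun a h h' => (smul_inv_smul g a).symm
  · intro b a₀ a₁ h₁ h₀
    have e : q a₀ = a₁ := h₀
    subst e
    exact ⟨a₀, ⟨h₁, rfl, rfl⟩, fun a h => h.2.1⟩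

theorem Rb_comp_Nb_comp_Tb {A B : FinGSet.{u} G} (p : A →[G] X) (q : A →[G] B) (r : B →[G] Y) :
    (Rb p ≫ Nb q) ≫ Tb r = cls ⟨A, B, p, q, r⟩ := by
  rw [Rb, cls_comp_Nb, cls_comp_Tb]; rfl

theorem Tb_id : Tb (MulActionHom.id G : X →[G] X) = 𝟙 X := rfl

theorem Nb_id : Nb (MulActionHom.id G : X →[G] X) = 𝟙 X := rfl

theorem Rb_id : Rb (MulActionHom.id G : X →[G] X) = 𝟙 X := rfl

theorem Tb_comp (f : X →[G] Y) (g : Y →[G] Z) : Tb f ≫ Tb g = Tb (g.comp f) :=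
  cls_comp_Tb _ _ _ _

theorem Nb_comp (f : X →[G] Y) (g : Y →[G] Z) : Nb f ≫ Nb g = Nb (g.comp f) :=
  cls_comp_Nb _ _ _

/-- A cartesian square of finite `G`-sets. -/
def IsCartesian (f : W →[G] X) (g : W →[G] Y) (h : X →[G] Z) (k : Y →[G] Z) : Prop :=
  (∀ w, h (f w) = k (g w)) ∧ ∀ x y, h x = k y → ∃! w, f w = x ∧ g w = y

theorem Tb_comp_Rb {f : W →[G] X} {g : W →[G] Y} {h : X →[G] Z} {k : Y →[G] Z}
    (H : IsCartesian f g h k) : Tb h ≫ Rb k = Rb f ≫ Tb g := by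
  rw [Rb, Rb, cls_comp_Tb]
  refine (Quotient.sound ?_).symm
  refine Bispan.IsIso.comp_of (ω := ⟨W, W, f, MulActionHom.id G, g.comp (MulActionHom.id G)⟩)
    (ω₀ := ⟨X, X, MulActionHom.id G, MulActionHom.id G, h⟩)
    (ω₁ := ⟨Y, Y, k, MulActionHom.id G, MulActionHom.id G⟩)
    (fun w => ⟨g w, fun _ => f w, fun a => ?_⟩) ⟨?_, ?_⟩ ?_
    f g (fun _ => rfl) (fun _ => rfl) (fun _ => rfl) (fun _ => rfl) ?_
  · rw [show a.1 = g w from a.2]; exact H.1 w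
  · intro w w' e
    have e1 : g w = g w' := congrArg Bispan.CompB.b e
    exact (H.2 _ _ (H.1 w')).unique ⟨Bispan.CompB.s_congr e e1 rfl rfl, e1⟩ ⟨rfl, rfl⟩
  · rintro ⟨b, s, hs⟩
    obtain ⟨w, ⟨h1, h2⟩, -⟩ := H.2 (s ⟨b, rfl⟩) b (hs _)
    refine ⟨w, Bispan.CompB.ext' h2 ?_⟩
    intro a e e'
    obtain rfl : a = b := e'
    exact h1
  · intro c w
    exact Bispan.CompB.ext' (map_smul g c w) fun a e e' => map_smul f c w
  · intro b a₀ a₁ h₁ h₀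
    have e0 : a₀ = f b := h₀
    have e1 : a₁ = g b := h₁
    subst e0 e1
    exact ⟨b, ⟨rfl, rfl, rfl⟩, fun a h => h.1⟩

theorem Nb_comp_Rb {f : W →[G] X} {g : W →[G] Y} {h : X →[G] Z} {k : Y →[G] Z}
    (H : IsCartesian f g h k) : Nb h ≫ Rb k = Rb f ≫ Nb g := by
  rw [Rb, Rb, cls_comp_Nb]
  refine (Quotient.sound ?_).symm
  refine Bispan.IsIso.comp_of (ω := ⟨W, Y, f, g.comp (MulActionHom.id G), MulActionHom.id G⟩)
    (ω₀ := ⟨X, Z, MulActionHom.id G, h, MulActionHom.id G⟩)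
    (ω₁ := ⟨Y, Y, k, MulActionHom.id G, MulActionHom.id G⟩)
    (fun y => ⟨y, fun _ => k y, fun a => congrArg k (Eq.symm a.2)⟩) ⟨?_, ?_⟩ ?_
    f g (fun _ => rfl) H.1 (fun _ => rfl) (fun _ => rfl) ?_
  · intro b b' h
    exact congrArg Bispan.CompB.b h
  · rintro ⟨b, s, hs⟩
    refine ⟨b, Bispan.CompB.ext' rfl fun a h h' => ?_⟩
    obtain rfl : a = b := h
    exact (hs ⟨a, rfl⟩).symm
  · intro c y
    exact Bispan.CompB.ext' rfl fun a h h' => map_smul k c y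
  · intro b a₀ a₁ h₁ h₀
    have e1 : a₁ = b := h₁
    subst e1
    obtain ⟨w, ⟨k1, k2⟩, k3⟩ := H.2 a₀ a₁ h₀
    exact ⟨w, ⟨k2, k1, k2⟩, fun w' h' => k3 _ h'.2⟩

/-- `N_g T_f = T_r N_q R_p` whenever `(p, q, r)` has the defining property of the distributor. -/
theorem Tb_comp_Nb {A B : FinGSet.{u} G} {f : X →[G] Y} {g : Y →[G] Z} (p : A →[G] X)
    (q : A →[G] B) (r : B →[G] Z) (m : A →[G] Y) (hm : ∀ a, f (p a) = m a)
    (H : IsCartesian m q g r)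
    (hD : ∀ z (s : ∀ y, g y = z → X), (∀ y h, f (s y h) = y) →
      ∃! b, r b = z ∧ ∀ a, q a = b → ∀ h, p a = s (m a) h) :
    Tb f ≫ Nb g = cls ⟨A, B, p, q, r⟩ := by
  refine (Quotient.sound ?_).symm
  choose t ht ht' using fun y b (h : g y = r b) => (H.2 y b h)
  have key : ∀ a b (h : g (m a) = r b), q a = b → t (m a) b h = a := fun a b h e =>
    (ht' (m a) b h a ⟨rfl, e⟩).symm
  refine Bispan.IsIso.comp_of (ω := ⟨A, B, p, q, r⟩)
    (ω₀ := ⟨X, X, MulActionHom.id G, MulActionHom.id G, f⟩)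
    (ω₁ := ⟨Y, Z, MulActionHom.id G, g, MulActionHom.id G⟩)
    (fun b => ⟨r b, fun y => p (t y.1 b y.2), fun y => (hm _).trans (ht y.1 b y.2).1⟩)
    ⟨?_, ?_⟩ ?_ p m H.1 ?_ (fun _ => rfl) (fun _ => rfl) ?_
  · intro b b' h
    have e : r b = r b' := congrArg Bispan.CompB.b h
    refine (hD (r b') (fun y h => p (t y b' h)) fun y h => (hm _).trans (ht y b' h).1).unique
      ⟨e, fun a ha h' => ?_⟩ ⟨rfl, fun a ha h' => ?_⟩
    · refine Eq.trans ?_ (Bispan.CompB.s_congr h rfl ((H.1 a).trans (congrArg r ha)) h')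
      exact congrArg p (key a b _ ha).symm
    · rw [key a b' _ ha]
  · rintro ⟨z, s, hs⟩
    obtain ⟨b, ⟨rfl, hb⟩, -⟩ := hD z (fun y h => s ⟨y, h⟩) fun y h => hs ⟨y, h⟩
    refine ⟨b, Bispan.CompB.ext' rfl fun y h h' => ?_⟩
    have e1 : m (t y b h) = y := (ht y b h).1
    refine (hb (t y b h) (ht y b h).2 (by rw [e1]; exact h)).trans ?_
    exact congrArg s (Subtype.ext e1)
  · intro c b
    refine Bispan.CompB.ext' (map_smul r c b) fun y h h' => ?_
    have e : g (c⁻¹ • y) = r b := by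
      rw [map_smul, show g y = r (c • b) from h, map_smul, inv_smul_smul]
    change p (t y (c • b) _) = c • p (t (c⁻¹ • y) b e)
    rw [← map_smul]
    congr 1
    refine (ht' y (c • b) h _ ⟨?_, ?_⟩).symm
    · rw [map_smul, (ht _ _ e).1, smul_inv_smul]
    · rw [map_smul, (ht _ _ e).2]
  · intro a
    exact congrArg p (key a _ _ rfl).symm
  · intro b a₀ a₁ h₁ h₀
    refine ⟨t a₁ b h₁, ⟨(ht _ _ _).2, h₀.symm, (ht _ _ _).1⟩, fun a h => ht' _ _ _ _ ⟨h.2.2, h.1⟩⟩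

theorem Rb_comp (f : X →[G] Y) (g : Y →[G] Z) : Rb g ≫ Rb f = Rb (g.comp f) := by
  refine (Quotient.sound ?_).symm
  refine Bispan.IsIso.comp_of (ω := ⟨X, X, g.comp f, MulActionHom.id G, MulActionHom.id G⟩)
    (ω₀ := ⟨Y, Y, g, MulActionHom.id G, MulActionHom.id G⟩)
    (ω₁ := ⟨X, X, f, MulActionHom.id G, MulActionHom.id G⟩)
    (fun y => ⟨y, fun _ => f y, fun a => congrArg f (Eq.symm a.2)⟩) ⟨?_, ?_⟩ ?_
    f (MulActionHom.id G) (fun _ => rfl) (fun _ => rfl) (fun _ => rfl) (fun _ => rfl) ?_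
  · intro b b' h
    exact congrArg Bispan.CompB.b h
  · rintro ⟨b, s, hs⟩
    refine ⟨b, Bispan.CompB.ext' rfl fun a h h' => ?_⟩
    obtain rfl : a = b := h
    exact (hs ⟨a, rfl⟩).symm
  · intro c y
    exact Bispan.CompB.ext' rfl fun a h h' => map_smul f c y
  · intro b a₀ a₁ h₁ h₀
    exact ⟨b, ⟨rfl, h₀.symm, h₁.symm⟩, fun a h => h.1⟩

end Generators

section Products

variable {X Y U : FinGSet.{u} G}

/-- The bispan into `X ⊔ Y` with given components. -/
def Bispan.pair (ω : Bispan U X) (ω' : Bispan U Y) : Bispan U (sum X Y) :=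
  ⟨sum ω.A ω'.A, sum ω.B ω'.B, desc ω.p ω'.p, sumMap ω.q ω'.q, sumMap ω.r ω'.r⟩

theorem Bispan.pair_congr {ω ω₁ : Bispan U X} {ω' ω₁' : Bispan U Y} (h : IsIso ω ω₁)
    (h' : IsIso ω' ω₁') : IsIso (pair ω ω') (pair ω₁ ω₁') := by
  obtain ⟨α, β, hα, hβ, hp, hq, hr⟩ := h
  obtain ⟨α', β', hα', hβ', hp', hq', hr'⟩ := h'
  refine ⟨sumMap α α', sumMap β β', Sum.map_bijective.2 ⟨hα, hα'⟩,
    Sum.map_bijective.2 ⟨hβ, hβ'⟩, ?_, ?_, ?_⟩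
  · rintro (a | a)
    exacts [hp a, hp' a]
  · rintro (a | a)
    exacts [congrArg Sum.inl (hq a), congrArg Sum.inr (hq' a)]
  · rintro (a | a)
    exacts [congrArg Sum.inl (hr a), congrArg Sum.inr (hr' a)]

/-- The morphism into `X ⊔ Y` with given components. -/
def pairHom (f : U ⟶ X) (g : U ⟶ Y) : U ⟶ sum X Y :=
  Quotient.map₂ Bispan.pair (fun _ _ h _ _ h' => Bispan.pair_congr h h') f g

theorem pairHom_inl (f : U ⟶ X) (g : U ⟶ Y) : pairHom f g ≫ Rb inl = f := by
  obtain ⟨ω⟩ := f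
  obtain ⟨ω'⟩ := g
  refine (Quotient.sound ?_).symm
  refine Bispan.IsIso.comp_of (ω := ω) (ω₀ := Bispan.pair ω ω')
    (ω₁ := ⟨X, X, inl, MulActionHom.id G, MulActionHom.id G⟩)
    (fun b => ⟨ω.r b, fun _ => Sum.inl b, fun a => congrArg Sum.inl a.2.symm⟩) ⟨?_, ?_⟩ ?_
    inl (ω.r.comp ω.q) (fun _ => rfl) (fun _ => rfl) (fun _ => rfl) (fun _ => rfl) ?_
  · intro b b' h
    exact Sum.inl_injective (Bispan.CompB.s_congr h (congrArg Bispan.CompB.b h) rfl rfl)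
  · rintro ⟨x, s, hs⟩
    have e := hs ⟨x, rfl⟩
    rcases hb : s ⟨x, rfl⟩ with b | b
    · rw [hb] at e
      obtain rfl : ω.r b = x := Sum.inl_injective e
      refine ⟨b, Bispan.CompB.ext' rfl ?_⟩
      intro a h h'
      obtain rfl : a = ω.r b := h
      exact hb.symm
    · rw [hb] at e
      cases e
  · intro c b
    exact Bispan.CompB.ext' (map_smul ω.r c b) fun a h h' => rfl
  · rintro b (a₀ | a₀) a₁ h₁ h₀
    · obtain rfl : ω.q a₀ = b := Sum.inl_injective h₀
      obtain rfl : a₁ = ω.r (ω.q a₀) := h₁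
      exact ⟨a₀, ⟨rfl, rfl, rfl⟩, fun a h => Sum.inl_injective h.2.1⟩
    · cases h₀

theorem pairHom_inr (f : U ⟶ X) (g : U ⟶ Y) : pairHom f g ≫ Rb inr = g := by
  obtain ⟨ω⟩ := f
  obtain ⟨ω'⟩ := g
  refine (Quotient.sound ?_).symm
  refine Bispan.IsIso.comp_of (ω := ω') (ω₀ := Bispan.pair ω ω')
    (ω₁ := ⟨Y, Y, inr, MulActionHom.id G, MulActionHom.id G⟩)
    (fun b => ⟨ω'.r b, fun _ => Sum.inr b, fun a => congrArg Sum.inr a.2.symm⟩) ⟨?_, ?_⟩ ?_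
    inr (ω'.r.comp ω'.q) (fun _ => rfl) (fun _ => rfl) (fun _ => rfl) (fun _ => rfl) ?_
  · intro b b' h
    exact Sum.inr_injective (Bispan.CompB.s_congr h (congrArg Bispan.CompB.b h) rfl rfl)
  · rintro ⟨x, s, hs⟩
    have e := hs ⟨x, rfl⟩
    rcases hb : s ⟨x, rfl⟩ with b | b
    · rw [hb] at e
      cases e
    · rw [hb] at e
      obtain rfl : ω'.r b = x := Sum.inr_injective e
      refine ⟨b, Bispan.CompB.ext' rfl ?_⟩
      intro a h h'
      obtain rfl : a = ω'.r b := h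
      exact hb.symm
  · intro c b
    exact Bispan.CompB.ext' (map_smul ω'.r c b) fun a h h' => rfl
  · rintro b (a₀ | a₀) a₁ h₁ h₀
    · cases h₀
    · obtain rfl : ω'.q a₀ = b := Sum.inr_injective h₀
      obtain rfl : a₁ = ω'.r (ω'.q a₀) := h₁
      exact ⟨a₀, ⟨rfl, rfl, rfl⟩, fun a h => Sum.inr_injective h.2.1⟩

theorem pairHom_eta (f : U ⟶ sum X Y) : pairHom (f ≫ Rb inl) (f ≫ Rb inr) = f := by
  obtain ⟨ω⟩ := f
  refine Quotient.sound ?_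
  let ρ : Bispan (sum X Y) X := ⟨X, X, inl, MulActionHom.id G, MulActionHom.id G⟩
  let ρ' : Bispan (sum X Y) Y := ⟨Y, Y, inr, MulActionHom.id G, MulActionHom.id G⟩
  have hs : ∀ (c : Bispan.CompB ω ρ) (x : X) (h : x = c.b),
      c.s ⟨x, h⟩ = c.s ⟨c.b, rfl⟩ := fun c x h => Bispan.CompB.s_congr rfl h _ _
  have hs' : ∀ (c : Bispan.CompB ω ρ') (x : Y) (h : x = c.b),
      c.s ⟨x, h⟩ = c.s ⟨c.b, rfl⟩ := fun c x h => Bispan.CompB.s_congr rfl h _ _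
  have hr : ∀ c : Bispan.CompB ω ρ, ω.r (c.s ⟨c.b, rfl⟩) = Sum.inl c.b := fun c => c.hs _
  have hr' : ∀ c : Bispan.CompB ω ρ', ω.r (c.s ⟨c.b, rfl⟩) = Sum.inr c.b := fun c => c.hs _
  have hinj : ∀ c d : Bispan.CompB ω ρ, c.s ⟨c.b, rfl⟩ = d.s ⟨d.b, rfl⟩ → c = d := by
    intro c d h
    refine Bispan.CompB.ext' (Sum.inl_injective (by rw [← hr, ← hr, h])) fun x h₁ h₂ => ?_
    rw [hs c x h₁, hs d x h₂, h]
  have hinj' : ∀ c d : Bispan.CompB ω ρ', c.s ⟨c.b, rfl⟩ = d.s ⟨d.b, rfl⟩ → c = d := by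
    intro c d h
    refine Bispan.CompB.ext' (Sum.inr_injective (by rw [← hr', ← hr', h])) fun x h₁ h₂ => ?_
    rw [hs' c x h₁, hs' d x h₂, h]
  have hA : ∀ c : Bispan.CompA ω ρ, ω.q c.a₀ = c.b.s ⟨c.b.b, rfl⟩ := fun c =>
    c.h₀.trans (hs _ _ _)
  have hA' : ∀ c : Bispan.CompA ω ρ', ω.q c.a₀ = c.b.s ⟨c.b.b, rfl⟩ := fun c =>
    c.h₀.trans (hs' _ _ _)
  refine ⟨desc (X := (ω.comp ρ).A) (Y := (ω.comp ρ').A)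
      ⟨fun c : Bispan.CompA ω ρ => c.a₀, fun _ _ => rfl⟩
      ⟨fun c : Bispan.CompA ω ρ' => c.a₀, fun _ _ => rfl⟩,
    desc (X := (ω.comp ρ).B) (Y := (ω.comp ρ').B)
      ⟨fun c : Bispan.CompB ω ρ => c.s ⟨c.b, rfl⟩, fun g c => ?_⟩
      ⟨fun c : Bispan.CompB ω ρ' => c.s ⟨c.b, rfl⟩, fun g c => ?_⟩, ⟨?_, ?_⟩, ⟨?_, ?_⟩,
      ?_, ?_, ?_⟩
  · exact Bispan.CompB.smul_s_smul g c c.b rfl rfl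
  · exact Bispan.CompB.smul_s_smul g c c.b rfl rfl
  · rintro (c | c) (d | d) h
    · have h : Bispan.CompA.a₀ c = Bispan.CompA.a₀ d := h
      have e : Bispan.CompA.b c = Bispan.CompA.b d := hinj _ _ (by rw [← hA c, ← hA d, h])
      refine congrArg Sum.inl (Bispan.CompA.ext' e ?_ h)
      exact (Bispan.CompA.h₁ c).trans ((congrArg Bispan.CompB.b e).trans
        (Bispan.CompA.h₁ d).symm)
    · have h : Bispan.CompA.a₀ c = Bispan.CompA.a₀ d := h
      have e := hA c
      rw [h, hA' d] at e
      have := (hr' _).symm.trans ((congrArg ω.r e).trans (hr _))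
      cases this
    · have h : Bispan.CompA.a₀ c = Bispan.CompA.a₀ d := h
      have e := hA' c
      rw [h, hA d] at e
      have := (hr _).symm.trans ((congrArg ω.r e).trans (hr' _))
      cases this
    · have h : Bispan.CompA.a₀ c = Bispan.CompA.a₀ d := h
      have e : Bispan.CompA.b c = Bispan.CompA.b d := hinj' _ _ (by rw [← hA' c, ← hA' d, h])
      refine congrArg Sum.inr (Bispan.CompA.ext' e ?_ h)
      exact (Bispan.CompA.h₁ c).trans ((congrArg Bispan.CompB.b e).trans
        (Bispan.CompA.h₁ d).symm)
  · intro a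
    rcases h : ω.r (ω.q a) with x | y
    · exact ⟨Sum.inl (⟨⟨x, fun _ => ω.q a, fun z => h.trans (congrArg Sum.inl z.2.symm)⟩, x, rfl,
        a, rfl⟩ : Bispan.CompA ω ρ), rfl⟩
    · exact ⟨Sum.inr (⟨⟨y, fun _ => ω.q a, fun z => h.trans (congrArg Sum.inr z.2.symm)⟩, y, rfl,
        a, rfl⟩ : Bispan.CompA ω ρ'), rfl⟩
  · rintro (c | c) (d | d) h
    · exact congrArg Sum.inl (hinj c d h)
    · have := (hr c).symm.trans ((congrArg ω.r h).trans (hr' d))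
      cases this
    · have := (hr' c).symm.trans ((congrArg ω.r h).trans (hr d))
      cases this
    · exact congrArg Sum.inr (hinj' c d h)
  · intro b
    rcases h : ω.r b with x | y
    · exact ⟨Sum.inl (⟨x, fun _ => b, fun z => h.trans (congrArg Sum.inl z.2.symm)⟩ :
        Bispan.CompB ω ρ), rfl⟩
    · exact ⟨Sum.inr (⟨y, fun _ => b, fun z => h.trans (congrArg Sum.inr z.2.symm)⟩ :
        Bispan.CompB ω ρ'), rfl⟩
  · rintro (c | c) <;> rfl
  · rintro (c | c)
    exacts [hA c, hA' c]
  · rintro (c | c)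
    exacts [hr c, hr' c]

/-- `X ← X ⊔ Y → Y` is a product diagram in the category of bispans. -/
def isLimitSum (X Y : FinGSet.{u} G) :
    IsLimit (BinaryFan.mk (Rb inl : sum X Y ⟶ X) (Rb inr : sum X Y ⟶ Y)) :=
  BinaryFan.isLimitMk (fun s => pairHom s.fst s.snd) (fun _ => pairHom_inl _ _)
    (fun _ => pairHom_inr _ _) (fun s m h₁ h₂ => by rw [← h₁, ← h₂, pairHom_eta])

/-- The empty `G`-set is terminal in the category of bispans. -/
def isTerminalEmpty : IsTerminal (empty : FinGSet.{u} G) :=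
  IsTerminal.ofUniqueHom (fun X => cls ⟨empty, empty, fromEmpty X, MulActionHom.id G,
    MulActionHom.id G⟩) (by
      rintro X ⟨ω⟩
      refine Quotient.sound ?_
      have hB : ω.B → False := fun b => PEmpty.elim (ω.r b)
      have hA : ω.A → False := fun a => hB (ω.q a)
      exact ⟨⟨fun a => (hA a).elim, fun _ a => (hA a).elim⟩,
        ⟨fun a => (hB a).elim, fun _ a => (hB a).elim⟩,
        ⟨fun a => (hA a).elim, fun a => PEmpty.elim a⟩,
        ⟨fun a => (hB a).elim, fun a => PEmpty.elim a⟩, fun a => (hA a).elim,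
        fun a => (hA a).elim, fun a => (hB a).elim⟩)

end Products

/-- A Tambara functor: a product-preserving functor from the category of bispans to sets. -/
structure TambaraFunctor (G : Type v) [Group G] where
  /-- the underlying functor -/
  toFunctor : FinGSet.{u} G ⥤ Type w
  preserves : PreservesFiniteProducts toFunctor

namespace TambaraFunctor

attribute [instance] TambaraFunctor.preserves

instance : CoeFun (TambaraFunctor.{u, v, w} G) (fun _ => FinGSet.{u} G → Type w) :=
  ⟨fun S => S.toFunctor.obj⟩

variable (S : TambaraFunctor.{u, v, w} G) {X Y Z W X' Y' : FinGSet.{u} G}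

/-- The restriction `R_f : S(Y) → S(X)`. -/
def R (f : X →[G] Y) (a : S Y) : S X := S.toFunctor.map (Rb f) a

/-- The transfer `T_f : S(X) → S(Y)`. -/
def T (f : X →[G] Y) (a : S X) : S Y := S.toFunctor.map (Tb f) a

/-- The norm `N_f : S(X) → S(Y)`. -/
def N (f : X →[G] Y) (a : S X) : S Y := S.toFunctor.map (Nb f) a

theorem existsUnique_pair (a : S X) (b : S Y) :
    ∃! c : S (sum X Y), S.R inl c = a ∧ S.R inr c = b := by
  have hl := mapIsLimitOfPreservesOfIsLimit S.toFunctor _ _ (isLimitSum X Y)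
  obtain ⟨c, h₁, h₂⟩ := BinaryFan.IsLimit.lift' hl (↾fun _ : PUnit.{w + 1} => a)
    (↾fun _ : PUnit.{w + 1} => b)
  refine ⟨c PUnit.unit, ⟨?_, ?_⟩, ?_⟩
  · exact ConcreteCategory.congr_hom h₁ PUnit.unit
  · exact ConcreteCategory.congr_hom h₂ PUnit.unit
  · rintro d ⟨h₃, h₄⟩
    have : (↾fun _ : PUnit.{w + 1} => d) = c := BinaryFan.IsLimit.hom_ext hl
      (Eq.trans (by ext; exact h₃) h₁.symm) (Eq.trans (by ext; exact h₄) h₂.symm)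
    exact ConcreteCategory.congr_hom this PUnit.unit

theorem existsUnique_empty : ∃! _ : S empty, True := by
  have hl := IsTerminal.isTerminalObj S.toFunctor _ (isTerminalEmpty (G := G))
  refine ⟨hl.from PUnit.{w + 1} PUnit.unit, trivial, fun d _ => ?_⟩
  exact ConcreteCategory.congr_hom (hl.hom_ext (↾fun _ : PUnit.{w + 1} => d) (hl.from _))
    PUnit.unit

/-- The element of `S(X ⊔ Y) ≃ S(X) × S(Y)` corresponding to `(a, b)`. -/
noncomputable def pair (a : S X) (b : S Y) : S (sum X Y) := (S.existsUnique_pair a b).choose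

/-- The unique element of `S(∅)`. -/
noncomputable def pt : S empty := S.existsUnique_empty.choose

theorem R_inl_pair (a : S X) (b : S Y) : S.R inl (S.pair a b) = a :=
  (S.existsUnique_pair a b).choose_spec.1.1

theorem R_inr_pair (a : S X) (b : S Y) : S.R inr (S.pair a b) = b :=
  (S.existsUnique_pair a b).choose_spec.1.2

variable {S} in
theorem sum_ext {c d : S (sum X Y)} (h : S.R inl c = S.R inl d) (h' : S.R inr c = S.R inr d) :
    c = d :=
  (S.existsUnique_pair _ _).unique ⟨h, h'⟩ ⟨rfl, rfl⟩

theorem empty_ext (a b : S empty) : a = b := S.existsUnique_empty.unique trivial trivial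

theorem R_id (a : S X) : S.R (MulActionHom.id G) a = a := by
  rw [R, Rb_id, S.toFunctor.map_id]; rfl

theorem R_R (f : X →[G] Y) (g : Y →[G] Z) (a : S Z) : S.R f (S.R g a) = S.R (g.comp f) a := by
  rw [R, R, R, ← Rb_comp, S.toFunctor.map_comp]; rfl

theorem R_desc (f : X →[G] Z) (g : Y →[G] Z) (a : S Z) :
    S.R (desc f g) a = S.pair (S.R f a) (S.R g a) := by
  refine sum_ext ?_ ?_
  · rw [R_inl_pair, R_R]; rfl
  · rw [R_inr_pair, R_R]; rfl

theorem R_sumMap (f : X →[G] X') (g : Y →[G] Y') (a : S X') (b : S Y') :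
    S.R (sumMap f g) (S.pair a b) = S.pair (S.R f a) (S.R g b) := by
  rw [sumMap, R_desc, ← R_R, ← R_R, R_inl_pair, R_inr_pair]

/-- A family of covariant operations satisfying base change; used for both `T` and `N`. -/
structure CovariantOp where
  /-- the operation -/
  op : ∀ {X Y : FinGSet.{u} G}, (X →[G] Y) → S X → S Y
  op_id : ∀ {X : FinGSet.{u} G} (a : S X), op (MulActionHom.id G) a = a
  op_op : ∀ {X Y Z : FinGSet.{u} G} (f : X →[G] Y) (g : Y →[G] Z) (a : S X),
    op g (op f a) = op (g.comp f) a
  op_R : ∀ {W X Y Z : FinGSet.{u} G} {f : W →[G] X} {g : W →[G] Y} {h : X →[G] Z} {k : Y →[G] Z},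
    IsCartesian f g h k → ∀ a, S.R k (op h a) = op g (S.R f a)

/-- The transfers. -/
def opT : CovariantOp S where
  op := S.T
  op_id a := by rw [T, Tb_id, S.toFunctor.map_id]; rfl
  op_op f g a := by rw [T, T, T, ← Tb_comp, S.toFunctor.map_comp]; rfl
  op_R H a := by
    have := ConcreteCategory.congr_hom (congrArg S.toFunctor.map (Tb_comp_Rb H)) a
    rwa [S.toFunctor.map_comp, S.toFunctor.map_comp] at this

/-- The norms. -/
def opN : CovariantOp S where
  op := S.N
  op_id a := by rw [N, Nb_id, S.toFunctor.map_id]; rfl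
  op_op f g a := by rw [N, N, N, ← Nb_comp, S.toFunctor.map_comp]; rfl
  op_R H a := by
    have := ConcreteCategory.congr_hom (congrArg S.toFunctor.map (Nb_comp_Rb H)) a
    rwa [S.toFunctor.map_comp, S.toFunctor.map_comp] at this

namespace CovariantOp

variable {S} (K : CovariantOp S)

theorem op_iso (f : X →[G] Y) (e : Y →[G] X) (h : ∀ x, e (f x) = x) (h' : ∀ y, f (e y) = y)
    (a : S X) : K.op f a = S.R e a := by
  have := K.op_R (f := MulActionHom.id G) (g := f) (h := MulActionHom.id G) (k := e)
    ⟨fun x => (h x).symm, fun x y hxy => ⟨x, ⟨rfl, by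
      rw [show x = e y from hxy, h']⟩, fun w hw => hw.1⟩⟩ a
  rw [K.op_id, S.R_id] at this
  exact this.symm

theorem op_sumMap (f : X →[G] X') (g : Y →[G] Y') (a : S X) (b : S Y) :
    K.op (sumMap f g) (S.pair a b) = S.pair (K.op f a) (K.op g b) := by
  refine sum_ext ?_ ?_
  · rw [S.R_inl_pair, K.op_R (f := inl) (g := f), S.R_inl_pair]
    refine ⟨fun _ => rfl, ?_⟩
    rintro (x | y) x' h
    · exact ⟨x, ⟨rfl, Sum.inl_injective h⟩, fun w hw => Sum.inl_injective hw.1⟩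
    · cases h
  · rw [S.R_inr_pair, K.op_R (f := inr) (g := g), S.R_inr_pair]
    refine ⟨fun _ => rfl, ?_⟩
    rintro (x | y) x' h
    · cases h
    · exact ⟨y, ⟨rfl, Sum.inr_injective h⟩, fun w hw => Sum.inr_injective hw.1⟩

/-- The binary operation induced by the fold map. -/
noncomputable def bin (a b : S X) : S X := K.op (fold X) (S.pair a b)

/-- The constant induced by the map from the empty set. -/
noncomputable def one (X : FinGSet.{u} G) : S X := K.op (fromEmpty X) S.pt

theorem bin_comm (a b : S X) : K.bin a b = K.bin b a := by
  let w : sum X X →[G] sum X X := desc inr inl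
  have hw : ∀ x, w (w x) = x := by rintro (x | x) <;> rfl
  have e1 : S.pair b a = K.op w (S.pair a b) := by
    rw [K.op_iso w w hw hw, R_desc, R_inl_pair, R_inr_pair]
  rw [bin, bin, e1, K.op_op]
  congr 1
  ext (x | x) <;> rfl

theorem bin_assoc (a b c : S X) : K.bin (K.bin a b) c = K.bin a (K.bin b c) := by
  have e1 : S.pair (K.bin a b) c =
      K.op (sumMap (fold X) (MulActionHom.id G)) (S.pair (S.pair a b) c) := by
    rw [op_sumMap, K.op_id]; rfl
  have e2 : S.pair a (K.bin b c) =
      K.op (sumMap (MulActionHom.id G) (fold X)) (S.pair a (S.pair b c)) := by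
    rw [op_sumMap, K.op_id]; rfl
  let f : sum (sum X X) X →[G] sum X (sum X X) :=
    desc (desc inl (inr.comp inl)) (inr.comp inr)
  let e : sum X (sum X X) →[G] sum (sum X X) X :=
    desc (inl.comp inl) (desc (inl.comp inr) inr)
  have e3 : S.pair a (S.pair b c) = K.op f (S.pair (S.pair a b) c) := by
    rw [K.op_iso f e (by rintro ((x | x) | x) <;> rfl) (by rintro (x | (x | x)) <;> rfl), R_desc,
      R_desc, ← R_R, ← R_R]
    simp only [R_inl_pair, R_inr_pair]
  change K.op (fold X) (S.pair (K.bin a b) c) = K.op (fold X) (S.pair a (K.bin b c))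
  rw [e1, e2, e3, K.op_op, K.op_op, K.op_op]
  congr 1
  ext ((x | x) | x) <;> rfl

theorem one_bin (a : S X) : K.bin (K.one X) a = a := by
  have e1 : S.pair (K.one X) a =
      K.op (sumMap (fromEmpty X) (MulActionHom.id G)) (S.pair S.pt a) := by
    rw [op_sumMap, K.op_id]; rfl
  rw [bin, e1, K.op_op, K.op_iso _ inr, R_inr_pair]
  · rintro (x | x)
    · exact PEmpty.elim x
    · rfl
  · intro x; rfl

end CovariantOp

theorem map_cls {A B : FinGSet.{u} G} (p : A →[G] X) (q : A →[G] B) (r : B →[G] Y) (a : S X) :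
    S.toFunctor.map (cls ⟨A, B, p, q, r⟩) a = S.T r (S.N q (S.R p a)) := by
  rw [← Rb_comp_Nb_comp_Tb, S.toFunctor.map_comp, S.toFunctor.map_comp]; rfl

/-- The distributive law in a Tambara functor. -/
theorem N_T {A B : FinGSet.{u} G} {f : X →[G] Y} {g : Y →[G] Z} (p : A →[G] X)
    (q : A →[G] B) (r : B →[G] Z) (m : A →[G] Y) (hm : ∀ a, f (p a) = m a)
    (H : IsCartesian m q g r)
    (hD : ∀ z (s : ∀ y, g y = z → X), (∀ y h, f (s y h) = y) →
      ∃! b, r b = z ∧ ∀ a, q a = b → ∀ h, p a = s (m a) h) (a : S X) :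
    S.N g (S.T f a) = S.T r (S.N q (S.R p a)) := by
  rw [← map_cls, ← Tb_comp_Nb p q r m hm H hD, S.toFunctor.map_comp]; rfl

/-- Addition `a + b = T_s(a, b)` and `0 = T_z()`, multiplication `a b = N_s(a, b)` and
`1 = N_z()`, for the fold map `s : X ⊔ X → X` and the inclusion `z : ∅ → X`. -/
noncomputable instance : Add (S X) := ⟨fun a b => S.T (fold X) (S.pair a b)⟩

noncomputable instance : Mul (S X) := ⟨fun a b => S.N (fold X) (S.pair a b)⟩

noncomputable instance : Zero (S X) := ⟨S.T (fromEmpty X) S.pt⟩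

noncomputable instance : One (S X) := ⟨S.N (fromEmpty X) S.pt⟩

theorem zero_mul' (a : S X) : 0 * a = 0 := by
  have e1 : S.pair (0 : S X) a =
      S.T (sumMap (fromEmpty X) (MulActionHom.id G)) (S.pair S.pt a) := by
    rw [show S.T = S.opT.op from rfl, CovariantOp.op_sumMap, CovariantOp.op_id]; rfl
  change S.N (fold X) (S.pair 0 a) = _
  rw [e1, S.N_T (A := empty) (B := empty) (fromEmpty _) (MulActionHom.id G) (fromEmpty _)
    (fromEmpty _) (fun a => PEmpty.elim a)]
  · rw [S.empty_ext (S.N _ _) S.pt]; rfl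
  · exact ⟨fun a => PEmpty.elim a, fun _ a => PEmpty.elim a⟩
  · intro z s hs
    have h := hs (Sum.inl z) rfl
    rcases hx : s (Sum.inl z) rfl with x | x
    · exact PEmpty.elim x
    · rw [hx] at h
      cases h

theorem mul_add' (a b c : S X) : a * (b + c) = a * b + a * c := by
  have e1 : S.pair a (b + c) =
      S.T (sumMap (MulActionHom.id G) (fold X)) (S.pair a (S.pair b c)) := by
    rw [show S.T = S.opT.op from rfl, CovariantOp.op_sumMap, CovariantOp.op_id]; rfl
  change S.N (fold X) (S.pair a (b + c)) = _
  rw [e1, S.N_T (A := sum (sum X X) (sum X X)) (B := sum X X)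
    (desc (desc inl (inr.comp inl)) (desc inl (inr.comp inr)))
    (sumMap (fold X) (fold X)) (fold X) (desc (MulActionHom.id G) (MulActionHom.id G))]
  · rw [R_desc, R_desc, R_desc, ← R_R, ← R_R, R_inl_pair, R_inr_pair, R_inl_pair, R_inr_pair,
      show S.N = S.opN.op from rfl, CovariantOp.op_sumMap]
    rfl
  · rintro ((x | x) | (x | x)) <;> rfl
  · constructor
    · rintro ((x | x) | (x | x)) <;> rfl
    · rintro (x | x) (y | y) h <;> obtain rfl : x = y := h
      · refine ⟨Sum.inl (Sum.inl x), ⟨rfl, rfl⟩, ?_⟩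
        rintro ((w | w) | (w | w)) ⟨h₁, h₂⟩ <;> cases h₁ <;> cases h₂
        rfl
      · refine ⟨Sum.inr (Sum.inl x), ⟨rfl, rfl⟩, ?_⟩
        rintro ((w | w) | (w | w)) ⟨h₁, h₂⟩ <;> cases h₁ <;> cases h₂
        rfl
      · refine ⟨Sum.inl (Sum.inr x), ⟨rfl, rfl⟩, ?_⟩
        rintro ((w | w) | (w | w)) ⟨h₁, h₂⟩ <;> cases h₁ <;> cases h₂
        rfl
      · refine ⟨Sum.inr (Sum.inr x), ⟨rfl, rfl⟩, ?_⟩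
        rintro ((w | w) | (w | w)) ⟨h₁, h₂⟩ <;> cases h₁ <;> cases h₂
        rfl
  · intro z s hs
    have h₁ : s (Sum.inl z) rfl = Sum.inl z := by
      have h := hs (Sum.inl z) rfl
      rcases hx : s (Sum.inl z) rfl with x | x
      · rw [hx] at h; exact congrArg _ (Sum.inl_injective h)
      · rw [hx] at h; cases h
    have h₂ : s (Sum.inr z) rfl = Sum.inr (Sum.inl z) ∨
        s (Sum.inr z) rfl = Sum.inr (Sum.inr z) := by
      have h := hs (Sum.inr z) rfl
      rcases hx : s (Sum.inr z) rfl with x | (x | x)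
      · rw [hx] at h; cases h
      · rw [hx] at h; exact Or.inl (congrArg _ (congrArg _ (Sum.inr_injective h)))
      · rw [hx] at h; exact Or.inr (congrArg _ (congrArg _ (Sum.inr_injective h)))
    rcases h₂ with h₂ | h₂
    · refine ⟨Sum.inl z, ⟨rfl, ?_⟩, ?_⟩
      · rintro ((x | x) | (x | x)) e e' <;> cases e
        exacts [h₁.symm, h₂.symm]
      · rintro (b | b) ⟨e, e'⟩ <;> obtain rfl : b = z := e
        · rfl
        · have := (e' (Sum.inr (Sum.inr b)) rfl rfl).trans h₂
          cases this
    · refine ⟨Sum.inr z, ⟨rfl, ?_⟩, ?_⟩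
      · rintro ((x | x) | (x | x)) e e' <;> cases e
        exacts [h₁.symm, h₂.symm]
      · rintro (b | b) ⟨e, e'⟩ <;> obtain rfl : b = z := e
        · have := (e' (Sum.inl (Sum.inr b)) rfl rfl).trans h₂
          cases this
        · rfl

noncomputable instance : CommSemiring (S X) where
  add_assoc := S.opT.bin_assoc
  zero_add := S.opT.one_bin
  add_zero a := (S.opT.bin_comm _ _).trans (S.opT.one_bin a)
  add_comm := S.opT.bin_comm
  mul_assoc := S.opN.bin_assoc
  one_mul := S.opN.one_bin
  mul_one a := (S.opN.bin_comm _ _).trans (S.opN.one_bin a)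
  mul_comm := S.opN.bin_comm
  zero_mul := S.zero_mul'
  mul_zero a := (S.opN.bin_comm _ _).trans (S.zero_mul' a)
  left_distrib := S.mul_add'
  right_distrib a b c := by
    have h := S.mul_add' c a b
    have e := fun x y : S X => show x * y = y * x from S.opN.bin_comm x y
    rwa [e c, e c, e c] at h
  nsmul := nsmulRec

/-- `S` is additively complete if every semiring `S(X)` has additive inverses. -/
def AdditivelyComplete : Prop := ∀ (X : FinGSet.{u} G) (a : S X), ∃ b : S X, a + b = 0

/-- A congruence on `S`: a sub-Tambara functor `E ≤ S × S` (that is, a subfunctor of the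
product `S × S` which itself preserves finite products) such that each `E(X) ⊆ S(X) × S(X)` is an
equivalence relation on `S(X)`. -/
structure Congruence where
  /-- the underlying subfunctor of `S × S` -/
  E : Subfunctor (FunctorToTypes.prod S.toFunctor S.toFunctor)
  preserves : PreservesFiniteProducts E.toFunctor
  equivalence : ∀ X : FinGSet.{u} G, Equivalence fun a b : S X => (a, b) ∈ E.obj X

/-- A Tambara ideal in `S`: ideals `I(X) ≤ S(X)` such that for every `f : X → Y` we have
`R_f(I(Y)) ⊆ I(X)`, `T_f(I(X)) ⊆ I(Y)` and `N_f(I(X)) ⊆ I(Y) + N_f(0)`. -/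
structure TambaraIdeal where
  /-- the ideals -/
  I : ∀ X : FinGSet.{u} G, Ideal (S X)
  R_mem : ∀ {X Y : FinGSet.{u} G} (f : X →[G] Y), ∀ a ∈ I Y, S.R f a ∈ I X
  T_mem : ∀ {X Y : FinGSet.{u} G} (f : X →[G] Y), ∀ a ∈ I X, S.T f a ∈ I Y
  N_mem : ∀ {X Y : FinGSet.{u} G} (f : X →[G] Y), ∀ a ∈ I X, ∃ c ∈ I Y, S.N f a = c + S.N f 0

end TambaraFunctor

end Tambara

/-!
Subtraction turns a congruence `E` into the ideal of elements congruent to `0`, and `E` is recovered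
as `(a, b) ∈ E(X) ↔ a - b ∈ I_E(X)`: as `E` preserves products, it is closed under pairing
`S(X) × S(Y) ≃ S(X ⊔ Y)`, hence under the addition and multiplication that are induced by the fold
map. That `I_E` is a Tambara ideal is then immediate; for norms, `N_f(a) - N_f(0)` lies in `I_E(Y)`
because `N_f(a)` and `N_f(0)` are congruent.

Conversely, let `J` be a Tambara ideal. Every morphism of bispans is a composite `T_r N_q R_p`, so
congruence modulo `J` is a subfunctor of `S × S` once it is stable under `R`, `N` and `T`. Both `R`
and `T` are additive, so only norms need an argument, and the condition on `N_f` in the definition of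
an ideal concerns the pair `(a, 0)` only. The reduction of a general pair `(b + c, b)` to it is
the formula `TambaraFunctor.N_add`, an instance of the distributive law,

  `N_g(b + c) = N_g(b) + T_r (N_q(R c) * N_q'(R b))`,

in which the second summand is indexed by the pairs `(y, U)` of a point `y` and a *nonempty* subset
`U` of `g⁻¹(y)`, and `q` is the projection to this index from the set of triples `(x, y, U)` with
`x ∈ U`. Since `U` is nonempty, `q` is surjective, so `N_q(0) = 0` (`N_zero_of_surjective`) and `N_q`
maps `J` into `J`. Hence `N_g(b + c) - N_g(b)` lies in `J` whenever `c` does. Finally, congruence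
modulo `J` preserves products because `S.pair c c' = T_inl(c) + T_inr(c')` lies in `J` if `c` and
`c'` do.
-/

namespace Tambara

open CategoryTheory Limits Function FinGSet

variable {G : Type v} [Group G]

/-! ### Product-preserving functors on the category of bispans -/

instance : HasFiniteProducts (FinGSet.{u} G) :=
  have : HasTerminal (FinGSet.{u} G) := isTerminalEmpty.hasTerminal
  have (X Y : FinGSet.{u} G) : HasLimit (pair X Y) := ⟨_, isLimitSum X Y⟩
  have := hasBinaryProducts_of_hasLimit_pair (FinGSet.{u} G)
  hasFiniteProducts_of_has_binary_and_terminal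

/-- A set-valued functor preserves finite products as soon as it sends `∅` to a one-point set and
`X ⊔ Y` to the product of the values at `X` and `Y`. -/
theorem preservesFiniteProducts_of_existsUnique (F : FinGSet.{u} G ⥤ Type w)
    (h₀ : ∃! _ : F.obj empty, True)
    (h₂ : ∀ (X Y : FinGSet.{u} G) (a : F.obj X) (b : F.obj Y),
      ∃! c : F.obj (sum X Y), F.map (Rb inl) c = a ∧ F.map (Rb inr) c = b) :
    PreservesFiniteProducts F := by
  have hpair : ∀ X Y : FinGSet.{u} G, PreservesLimit (pair X Y) F := by
    intro X Y
    refine preservesLimit_of_preserves_limit_cone (isLimitSum X Y)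
      ((isLimitMapConeBinaryFanEquiv F _ _).symm ?_)
    refine BinaryFan.isLimitMk (fun s => ↾fun x => (h₂ X Y (s.fst x) (s.snd x)).choose)
      (fun s => ?_) (fun s => ?_) (fun s m e₁ e₂ => ?_)
    · ext x
      exact (h₂ X Y (s.fst x) (s.snd x)).choose_spec.1.1
    · ext x
      exact (h₂ X Y (s.fst x) (s.snd x)).choose_spec.1.2
    · ext x
      exact (h₂ X Y (s.fst x) (s.snd x)).choose_spec.2 _
        ⟨ConcreteCategory.congr_hom e₁ x, ConcreteCategory.congr_hom e₂ x⟩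
  have : PreservesLimitsOfShape (Discrete WalkingPair) F :=
    ⟨fun {K} => preservesLimit_of_iso_diagram F (diagramIsoPair K).symm⟩
  have : PreservesLimit (Functor.empty.{0} (FinGSet.{u} G)) F := by
    refine preservesLimit_of_preserves_limit_cone (isTerminalEmpty (G := G))
      ((isLimitMapConeEmptyConeEquiv F _).symm ?_)
    refine IsTerminal.ofUniqueHom (fun _ => ↾fun _ => h₀.choose) fun Z m => ?_
    ext z
    exact h₀.unique trivial trivial
  have := preservesLimitsOfShape_pempty_of_preservesTerminal F
  exact .of_preserves_binary_and_terminal F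

/-- A functor preserving finite products sends `X ⊔ Y` to the product of its values. -/
theorem existsUnique_of_preservesFiniteProducts (F : FinGSet.{u} G ⥤ Type w)
    [PreservesFiniteProducts F] {X Y : FinGSet.{u} G} (a : F.obj X) (b : F.obj Y) :
    ∃! c : F.obj (sum X Y), F.map (Rb inl) c = a ∧ F.map (Rb inr) c = b :=
  TambaraFunctor.existsUnique_pair ⟨F, inferInstance⟩ a b

namespace TambaraFunctor

variable {S : TambaraFunctor.{u, v, w} G} {X Y Z : FinGSet.{u} G}

/-! ### Additivity and multiplicativity of the structure maps -/

namespace CovariantOp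

variable (K : CovariantOp S)

theorem op_desc_pair (f : X →[G] Z) (g : Y →[G] Z) (a : S X) (b : S Y) :
    K.op (desc f g) (S.pair a b) = K.bin (K.op f a) (K.op g b) := by
  rw [bin, ← op_sumMap, K.op_op]
  congr 1
  ext (x | x) <;> rfl

theorem op_bin (f : X →[G] Y) (a b : S X) :
    K.op f (K.bin a b) = K.bin (K.op f a) (K.op f b) := by
  rw [bin, K.op_op, ← op_desc_pair]
  congr 1
  ext (x | x) <;> rfl

theorem op_one (f : X →[G] Y) : K.op f (K.one X) = K.one Y := by
  rw [one, K.op_op, one]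
  congr 1
  ext x
  exact PEmpty.elim x

theorem R_bin (f : X →[G] Y) (a b : S Y) : S.R f (K.bin a b) = K.bin (S.R f a) (S.R f b) := by
  rw [bin, K.op_R (f := sumMap f f) (g := fold X), R_sumMap, bin]
  constructor
  · rintro (x | x) <;> rfl
  · rintro (y | y) x h <;> obtain rfl : y = f x := h
    · refine ⟨Sum.inl x, ⟨rfl, rfl⟩, ?_⟩
      rintro (w | w) ⟨e₁, e₂⟩
      exacts [congrArg Sum.inl e₂, (nomatch e₁)]
    · refine ⟨Sum.inr x, ⟨rfl, rfl⟩, ?_⟩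
      rintro (w | w) ⟨e₁, e₂⟩
      exacts [(nomatch e₁), congrArg Sum.inr e₂]

end CovariantOp

theorem T_add (f : X →[G] Y) (a b : S X) : S.T f (a + b) = S.T f a + S.T f b :=
  S.opT.op_bin f a b

theorem T_zero (f : X →[G] Y) : S.T f 0 = 0 := S.opT.op_one f

theorem R_add (f : X →[G] Y) (a b : S Y) : S.R f (a + b) = S.R f a + S.R f b :=
  S.opT.R_bin f a b

theorem R_zero (f : X →[G] Y) : S.R f 0 = 0 := by
  refine (S.opT.op_R (f := fromEmpty empty) (g := fromEmpty X) (h := fromEmpty Y) (k := f)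
    ⟨fun x => PEmpty.elim x, fun x => PEmpty.elim x⟩ S.pt).trans ?_
  exact congrArg (S.T (fromEmpty X)) (S.empty_ext _ _)

theorem T_desc_pair (f : X →[G] Z) (g : Y →[G] Z) (a : S X) (b : S Y) :
    S.T (desc f g) (S.pair a b) = S.T f a + S.T g b :=
  S.opT.op_desc_pair f g a b

theorem N_desc_pair (f : X →[G] Z) (g : Y →[G] Z) (a : S X) (b : S Y) :
    S.N (desc f g) (S.pair a b) = S.N f a * S.N g b :=
  S.opN.op_desc_pair f g a b

theorem N_sumMap_pair {X' Y' : FinGSet.{u} G} (f : X →[G] X') (g : Y →[G] Y') (a : S X)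
    (b : S Y) : S.N (sumMap f g) (S.pair a b) = S.pair (S.N f a) (S.N g b) :=
  S.opN.op_sumMap f g a b

theorem pair_add (a a' : S X) (b b' : S Y) :
    S.pair (a + a') (b + b') = S.pair a b + S.pair a' b' := by
  refine sum_ext ?_ ?_
  · rw [R_add, R_inl_pair, R_inl_pair, R_inl_pair]
  · rw [R_add, R_inr_pair, R_inr_pair, R_inr_pair]

theorem pair_eq_T_add_T (a : S X) (b : S Y) : S.pair a b = S.T inl a + S.T inr b := by
  rw [← T_desc_pair, show desc inl inr = MulActionHom.id G (X := sum X Y) by ext (x | x) <;> rfl]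
  exact (S.opT.op_id _).symm

/-- There is no section of `∅ → X` over a nonempty fibre of `f`, so the distributor of
`∅ → X → Y` is empty when `f` is surjective. -/
theorem N_zero_of_surjective (f : X →[G] Y) (hf : Surjective f) : S.N f 0 = 0 := by
  change S.N f (S.T (fromEmpty X) S.pt) = _
  rw [S.N_T (A := empty) (B := empty) (fromEmpty _) (MulActionHom.id G) (fromEmpty _)
    (fromEmpty _) (fun a => PEmpty.elim a)]
  · rw [S.empty_ext (S.N _ _) S.pt]; rfl
  · exact ⟨fun a => PEmpty.elim a, fun _ a => PEmpty.elim a⟩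
  · intro z s hs
    obtain ⟨x, hx⟩ := hf z
    exact PEmpty.elim (s x hx)

end TambaraFunctor

/-! ### The norm of a sum -/

namespace FiberSubset

open scoped Pointwise

variable {X Y : FinGSet.{u} G} (g : X →[G] Y)

/-- The `G`-set of pairs `(y, U)` with `U` a nonempty subset of `g⁻¹(y)`. -/
def index : FinGSet.{u} G :=
  ⟨({ carrier := {b | b.2.Nonempty ∧ ∀ x ∈ b.2, g x = b.1}
      smul_mem' := by
        rintro c ⟨y, U⟩ ⟨h, h'⟩
        refine ⟨h.smul_set, ?_⟩
        rintro _ ⟨x, hx, rfl⟩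
        exact (map_smul g c x).trans (congrArg (c • ·) (h' x hx)) } :
    SubMulAction G (Y × Set X))⟩

/-- The `G`-set of triples `(x, y, U)` with `(y, U)` in `index g` and `x ∈ U`. -/
def inside : FinGSet.{u} G :=
  ⟨({ carrier := {a | a.1 ∈ a.2.1.2}
      smul_mem' := fun _ _ h => Set.smul_mem_smul_set h } : SubMulAction G (X × index g))⟩

/-- The `G`-set of triples `(x, y, U)` with `(y, U)` in `index g` and `x ∈ g⁻¹(y) \ U`. -/
def outside : FinGSet.{u} G :=
  ⟨({ carrier := {a | g a.1 = a.2.1.1 ∧ a.1 ∉ a.2.1.2}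
      smul_mem' := fun c a h => ⟨(map_smul g c a.1).trans (congrArg (c • ·) h.1), fun h' =>
        h.2 (Set.smul_mem_smul_set_iff.1 h')⟩ } : SubMulAction G (X × index g))⟩

/-- The projection `(y, U) ↦ y`. -/
def toBase : index g →[G] Y := ⟨fun b => b.1.1, fun _ _ => rfl⟩

/-- The projection `(x, y, U) ↦ x` for `x ∈ U`. -/
def insidePoint : inside g →[G] X := ⟨fun a => a.1.1, fun _ _ => rfl⟩

/-- The projection `(x, y, U) ↦ (y, U)` for `x ∈ U`. -/
def insideIndex : inside g →[G] index g := ⟨fun a => a.1.2, fun _ _ => rfl⟩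

/-- The projection `(x, y, U) ↦ x` for `x ∉ U`. -/
def outsidePoint : outside g →[G] X := ⟨fun a => a.1.1, fun _ _ => rfl⟩

/-- The projection `(x, y, U) ↦ (y, U)` for `x ∉ U`. -/
def outsideIndex : outside g →[G] index g := ⟨fun a => a.1.2, fun _ _ => rfl⟩

theorem insideIndex_surjective : Surjective (insideIndex g) := by
  intro b
  obtain ⟨x, hx⟩ := b.2.1
  exact ⟨⟨(x, b), hx⟩, rfl⟩

variable {g}

theorem index_ext {b b' : index g} (h : toBase g b = toBase g b')
    (h' : ∀ x, x ∈ b.1.2 ↔ x ∈ b'.1.2) : b = b' :=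
  Subtype.ext (Prod.ext h (Set.ext h'))

end FiberSubset

namespace TambaraFunctor

open FiberSubset

variable {S : TambaraFunctor.{u, v, w} G} {X Y Z : FinGSet.{u} G}

/-- The norm of a sum `b + c` along `g` is a sum over the ways of choosing one of the two summands
at each point of a fibre; a choice is recorded by the set `U` of points where `c` is chosen. The
term `U = ∅` is `N_g(b)`, and the other terms are collected into a single transfer. -/
theorem N_add (g : X →[G] Y) (b c : S X) :
    S.N g (b + c) = S.N g b + S.T (toBase g) (S.N (insideIndex g) (S.R (insidePoint g) c) *
      S.N (outsideIndex g) (S.R (outsidePoint g) b)) := by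
  change S.N g (S.T (fold X) (S.pair b c)) = _
  -- A section of the fold map over `g⁻¹(y)` is a subset `U` of `g⁻¹(y)`; the empty subsets form the
  -- summand `Y` of the distributor, the nonempty ones the summand `index g`.
  rw [S.N_T (A := sum X (sum (inside g) (outside g))) (B := sum Y (index g))
    (desc inl (desc (inr.comp (insidePoint g)) (inl.comp (outsidePoint g))))
    (sumMap g (desc (insideIndex g) (outsideIndex g)))
    (desc (MulActionHom.id G) (toBase g))
    (desc (MulActionHom.id G) (desc (insidePoint g) (outsidePoint g)))]
  · rw [R_desc, R_desc, ← R_R, ← R_R, R_inl_pair, R_inr_pair, N_sumMap_pair, N_desc_pair,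
      T_desc_pair, show S.T (MulActionHom.id G) = _ from funext S.opT.op_id]
  · rintro (x | (a | a)) <;> rfl
  · constructor
    · rintro (x | (a | a))
      exacts [rfl, a.1.2.2.2 _ a.2, a.2.1]
    · rintro x (y | β) h
      · refine ⟨Sum.inl x, ⟨rfl, congrArg Sum.inl h⟩, ?_⟩
        rintro (x' | (a | a)) ⟨e₁, e₂⟩
        exacts [congrArg Sum.inl e₁, (nomatch e₂), (nomatch e₂)]
      · by_cases hx : x ∈ β.1.2
        · refine ⟨Sum.inr (Sum.inl ⟨(x, β), hx⟩), ⟨rfl, rfl⟩, ?_⟩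
          rintro (x' | (a | a)) ⟨e₁, e₂⟩
          · nomatch e₂
          · exact congrArg (Sum.inr ∘ Sum.inl)
              (Subtype.ext (Prod.ext e₁ (Sum.inr_injective e₂)))
          · obtain rfl : a.1.1 = x := e₁
            obtain rfl : a.1.2 = β := Sum.inr_injective e₂
            exact absurd hx a.2.2
        · refine ⟨Sum.inr (Sum.inr ⟨(x, β), h, hx⟩), ⟨rfl, rfl⟩, ?_⟩
          rintro (x' | (a | a)) ⟨e₁, e₂⟩
          · nomatch e₂
          · obtain rfl : a.1.1 = x := e₁
            obtain rfl : a.1.2 = β := Sum.inr_injective e₂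
            exact absurd a.2 hx
          · exact congrArg (Sum.inr ∘ Sum.inr)
              (Subtype.ext (Prod.ext e₁ (Sum.inr_injective e₂)))
  · intro y s hs
    have hs' : ∀ x h, s x h = Sum.inl x ∨ s x h = Sum.inr x := by
      intro x h
      have e := hs x h
      rcases hx : s x h with x' | x' <;> rw [hx] at e
      exacts [Or.inl (congrArg Sum.inl e), Or.inr (congrArg Sum.inr e)]
    by_cases hU : ∃ x h, s x h = Sum.inr x
    · let β : index g := ⟨(y, {x | ∃ h, s x h = Sum.inr x}), hU, fun x h => h.1⟩
      refine ⟨Sum.inr β, ⟨rfl, ?_⟩, ?_⟩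
      · rintro (x | (a | a)) e h
        · nomatch e
        · obtain e : a.1.2 = β := Sum.inr_injective e
          have ha : a.1.1 ∈ a.1.2.1.2 := a.2
          rw [e] at ha
          exact ha.2.symm
        · obtain e : a.1.2 = β := Sum.inr_injective e
          have ha : a.1.1 ∉ a.1.2.1.2 := a.2.2
          rw [e] at ha
          exact ((hs' a.1.1 h).resolve_right fun h' => ha ⟨h, h'⟩).symm
      · rintro (y' | γ) ⟨e, e'⟩
        · obtain rfl : y' = y := e
          obtain ⟨x, h, hx⟩ := hU
          have := (e' (Sum.inl x) (congrArg Sum.inl h) h).trans hx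
          nomatch this
        · obtain e : toBase g γ = y := e
          refine congrArg Sum.inr (index_ext e fun x => ⟨fun hx => ?_, fun hx => ?_⟩)
          · have h : g x = y := (γ.2.2 x hx).trans e
            exact ⟨h, (e' (Sum.inr (Sum.inl ⟨(x, γ), hx⟩)) rfl h).symm⟩
          · obtain ⟨h, hx⟩ := hx
            by_contra hx'
            have := (e' (Sum.inr (Sum.inr ⟨(x, γ), h.trans e.symm, hx'⟩)) rfl h).trans hx
            nomatch this
    · refine ⟨Sum.inl y, ⟨rfl, ?_⟩, ?_⟩
      · rintro (x | (a | a)) e h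
        · exact ((hs' x h).resolve_right fun h' => hU ⟨x, h, h'⟩).symm
        · nomatch e
        · nomatch e
      · rintro (y' | γ) ⟨e, e'⟩
        · exact congrArg Sum.inl e
        · obtain ⟨x, hx⟩ := γ.2.1
          have h : g x = y := (γ.2.2 x hx).trans e
          exact (hU ⟨x, h, (e' (Sum.inr (Sum.inl ⟨(x, γ), hx⟩)) rfl h).symm⟩).elim

/-- The ring structure on `S(X)` when `S` is additively complete. -/
noncomputable abbrev AdditivelyComplete.commRing (hS : S.AdditivelyComplete)
    (X : FinGSet.{u} G) : CommRing (S X) :=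
  let : Neg (S X) := ⟨fun a => (hS X a).choose⟩
  { (inferInstance : CommSemiring (S X)) with
    zsmul := zsmulRec
    neg_add_cancel := fun a => (add_comm _ _).trans (hS X a).choose_spec }

/-! ### The ideal of a congruence -/

namespace Congruence

variable (E : S.Congruence)

/-- The relation `(a, b) ∈ E(X)` on `S(X)`. -/
def Rel (a b : S X) : Prop := (a, b) ∈ E.E.obj X

theorem rel_refl (a : S X) : E.Rel a a := (E.equivalence X).refl a

variable {E}

theorem Rel.R (f : X →[G] Y) {a b : S Y} (h : E.Rel a b) : E.Rel (S.R f a) (S.R f b) :=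
  E.E.map (Rb f) h

theorem Rel.T (f : X →[G] Y) {a b : S X} (h : E.Rel a b) : E.Rel (S.T f a) (S.T f b) :=
  E.E.map (Tb f) h

theorem Rel.N (f : X →[G] Y) {a b : S X} (h : E.Rel a b) : E.Rel (S.N f a) (S.N f b) :=
  E.E.map (Nb f) h

/-- This is where preservation of products by `E` enters: it provides an element of `E(X ⊔ Y)`
with the given restrictions. -/
theorem Rel.pair {a a' : S X} {b b' : S Y} (h : E.Rel a a') (h' : E.Rel b b') :
    E.Rel (S.pair a b) (S.pair a' b') := by
  have := E.preserves
  obtain ⟨⟨⟨c, c'⟩, hc⟩, ⟨h₁, h₂⟩, -⟩ :=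
    existsUnique_of_preservesFiniteProducts E.E.toFunctor (X := X) (Y := Y)
      ⟨(a, a'), h⟩ ⟨(b, b'), h'⟩
  have e₁ := congrArg Subtype.val h₁
  have e₂ := congrArg Subtype.val h₂
  obtain rfl : c = S.pair a b := sum_ext
    ((congrArg Prod.fst e₁).trans (S.R_inl_pair a b).symm)
    ((congrArg Prod.fst e₂).trans (S.R_inr_pair a b).symm)
  obtain rfl : c' = S.pair a' b' := sum_ext
    ((congrArg Prod.snd e₁).trans (S.R_inl_pair a' b').symm)
    ((congrArg Prod.snd e₂).trans (S.R_inr_pair a' b').symm)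
  exact hc

theorem Rel.add {a a' b b' : S X} (h : E.Rel a a') (h' : E.Rel b b') :
    E.Rel (a + b) (a' + b') :=
  (h.pair h').T (fold X)

theorem Rel.mul {a a' b b' : S X} (h : E.Rel a a') (h' : E.Rel b b') :
    E.Rel (a * b) (a' * b') :=
  (h.pair h').N (fold X)

variable (E)

/-- The ideal `{a | (a, 0) ∈ E(X)}` of `S(X)`. -/
def idealAt (X : FinGSet.{u} G) : Ideal (S X) where
  carrier := {a | E.Rel a 0}
  add_mem' {a b} h h' := by simpa using Rel.add h h'
  zero_mem' := E.rel_refl 0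
  smul_mem' a b h := by simpa using (E.rel_refl a).mul h

theorem rel_iff_sub_mem (hS : S.AdditivelyComplete) {a b : S X} :
    let := hS.commRing X
    E.Rel a b ↔ a - b ∈ E.idealAt X := by
  let := hS.commRing X
  constructor
  · intro h
    have := h.add (E.rel_refl (-b))
    rwa [add_neg_cancel, ← sub_eq_add_neg] at this
  · intro h
    have := Rel.add (show E.Rel (a - b) 0 from h) (E.rel_refl b)
    rwa [sub_add_cancel, zero_add] at this

/-- The Tambara ideal `I_E(X) = {a | (a, 0) ∈ E(X)}` of a congruence `E`. -/
def toTambaraIdeal (hS : S.AdditivelyComplete) : S.TambaraIdeal where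
  I := E.idealAt
  R_mem f a h := by
    have := Rel.R f (show E.Rel a 0 from h)
    rwa [R_zero] at this
  T_mem f a h := by
    have := Rel.T f (show E.Rel a 0 from h)
    rwa [T_zero] at this
  N_mem {X Y} f a h := by
    let := hS.commRing Y
    exact ⟨S.N f a - S.N f 0, (E.rel_iff_sub_mem hS).1 (Rel.N f (show E.Rel a 0 from h)),
      (sub_add_cancel _ _).symm⟩

theorem toTambaraIdeal_injective (hS : S.AdditivelyComplete) :
    Injective fun E : S.Congruence => E.toTambaraIdeal hS := by
  intro E E' h
  have hI : E.idealAt = E'.idealAt := congrArg TambaraIdeal.I h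
  suffices E.E = E'.E by
    cases E; cases E'; cases this; rfl
  refine Subfunctor.ext (funext fun X => Set.ext fun ⟨a, b⟩ => ?_)
  exact (E.rel_iff_sub_mem hS).trans (hI ▸ (E'.rel_iff_sub_mem hS).symm)

end Congruence

/-! ### The congruence of a Tambara ideal -/

namespace TambaraIdeal

theorem ext_I : ∀ {J J' : S.TambaraIdeal}, J.I = J'.I → J = J'
  | ⟨_, _, _, _⟩, ⟨_, _, _, _⟩, rfl => rfl

variable (J : S.TambaraIdeal)

/-- The relation of congruence modulo `J(X)` on `S(X)`, stated without subtraction. -/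
def Rel (a b : S X) : Prop := ∃ c ∈ J.I X, a = b + c

theorem rel_equivalence (hS : S.AdditivelyComplete) (X : FinGSet.{u} G) :
    Equivalence (J.Rel (X := X)) where
  refl a := ⟨0, zero_mem _, (add_zero a).symm⟩
  symm := by
    let := hS.commRing X
    rintro _ b ⟨c, hc, rfl⟩
    exact ⟨-c, (Ideal.neg_mem_iff (J.I X)).2 hc, (add_neg_cancel_right b c).symm⟩
  trans := by
    rintro _ _ b ⟨c, hc, rfl⟩ ⟨c', hc', rfl⟩
    exact ⟨c' + c, add_mem hc' hc, add_assoc _ _ _⟩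

variable {J}

theorem Rel.R (f : X →[G] Y) {a b : S Y} (h : J.Rel a b) : J.Rel (S.R f a) (S.R f b) := by
  obtain ⟨c, hc, rfl⟩ := h
  exact ⟨S.R f c, J.R_mem f c hc, R_add f b c⟩

theorem Rel.T (f : X →[G] Y) {a b : S X} (h : J.Rel a b) : J.Rel (S.T f a) (S.T f b) := by
  obtain ⟨c, hc, rfl⟩ := h
  exact ⟨S.T f c, J.T_mem f c hc, T_add f b c⟩

/-- Along a surjection `N_f(0) = 0`, so the condition on norms becomes `N_f(J(X)) ⊆ J(Y)`. -/
theorem N_mem_of_surjective (f : X →[G] Y) (hf : Surjective f) {a : S X} (ha : a ∈ J.I X) :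
    S.N f a ∈ J.I Y := by
  obtain ⟨c, hc, h⟩ := J.N_mem f a ha
  rwa [h, N_zero_of_surjective f hf, add_zero]

theorem Rel.N (f : X →[G] Y) {a b : S X} (h : J.Rel a b) : J.Rel (S.N f a) (S.N f b) := by
  obtain ⟨c, hc, rfl⟩ := h
  exact ⟨_, J.T_mem _ _ (Ideal.mul_mem_right _ _
    (N_mem_of_surjective _ (insideIndex_surjective f) (J.R_mem _ _ hc))), N_add f b c⟩

theorem Rel.pair {a a' : S X} {b b' : S Y} (h : J.Rel a a') (h' : J.Rel b b') :
    J.Rel (S.pair a b) (S.pair a' b') := by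
  obtain ⟨c, hc, rfl⟩ := h
  obtain ⟨c', hc', rfl⟩ := h'
  refine ⟨S.pair c c', ?_, pair_add _ _ _ _⟩
  rw [pair_eq_T_add_T]
  exact add_mem (J.T_mem _ _ hc) (J.T_mem _ _ hc')

variable (J)

/-- Congruence modulo `J` as a subfunctor of `S × S`. -/
def subfunctor : Subfunctor (FunctorToTypes.prod S.toFunctor S.toFunctor) where
  obj X := {e | J.Rel e.1 e.2}
  map := by
    rintro X Y ⟨ω⟩ ⟨a, b⟩ h
    change J.Rel (S.toFunctor.map (cls ω) a) (S.toFunctor.map (cls ω) b)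
    rw [show ω = ⟨ω.A, ω.B, ω.p, ω.q, ω.r⟩ from rfl, map_cls, map_cls]
    exact ((Rel.R ω.p h).N ω.q).T ω.r

/-- Congruence modulo a Tambara ideal, as a congruence on `S`. -/
def toCongruence (hS : S.AdditivelyComplete) : S.Congruence where
  E := J.subfunctor
  preserves := by
    refine preservesFiniteProducts_of_existsUnique _
      ⟨⟨(S.pt, S.pt), (J.rel_equivalence hS _).refl _⟩, trivial, fun d _ =>
        Subtype.ext (Prod.ext (S.empty_ext _ _) (S.empty_ext _ _))⟩ ?_
    rintro X Y ⟨⟨a, a'⟩, ha⟩ ⟨⟨b, b'⟩, hb⟩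
    refine ⟨⟨(S.pair a b, S.pair a' b'), Rel.pair ha hb⟩,
      ⟨Subtype.ext (Prod.ext (S.R_inl_pair a b) (S.R_inl_pair a' b')),
        Subtype.ext (Prod.ext (S.R_inr_pair a b) (S.R_inr_pair a' b'))⟩, ?_⟩
    rintro ⟨⟨c, c'⟩, hc⟩ ⟨h₁, h₂⟩
    have e₁ := congrArg Subtype.val h₁
    have e₂ := congrArg Subtype.val h₂
    exact Subtype.ext (Prod.ext
      (sum_ext ((congrArg Prod.fst e₁).trans (S.R_inl_pair a b).symm)
        ((congrArg Prod.fst e₂).trans (S.R_inr_pair a b).symm))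
      (sum_ext ((congrArg Prod.snd e₁).trans (S.R_inl_pair a' b').symm)
        ((congrArg Prod.snd e₂).trans (S.R_inr_pair a' b').symm)))
  equivalence := J.rel_equivalence hS

theorem toTambaraIdeal_toCongruence (hS : S.AdditivelyComplete) :
    (J.toCongruence hS).toTambaraIdeal hS = J := by
  refine ext_I (funext fun X => ?_)
  ext a
  change (∃ c ∈ J.I X, a = 0 + c) ↔ a ∈ J.I X
  simp

end TambaraIdeal

end TambaraFunctor

end Tambara

theorem mainTheorem12 {G : Type v} [Group G] [Finite G]
    (S : Tambara.TambaraFunctor.{u, v, w} G) (hS : S.AdditivelyComplete) :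
    ∃ Φ : S.Congruence → S.TambaraIdeal,
      (∀ (E : S.Congruence) (X : Tambara.FinGSet.{u} G) (a : S X),
        a ∈ (Φ E).I X ↔ (a, (0 : S X)) ∈ E.E.obj X) ∧
      Function.Bijective Φ :=
  ⟨fun E => E.toTambaraIdeal hS, fun _ _ _ => Iff.rfl,
    Tambara.TambaraFunctor.Congruence.toTambaraIdeal_injective hS,
    fun J => ⟨J.toCongruence hS, J.toTambaraIdeal_toCongruence hS⟩⟩
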